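/- **Theorem 2 (quality of the transport map approximation).** Let $s>0$ and let $\mathbb B_s^d=\{x\in\mathbb R^d:\|x\|<s\}$ be the Poincaré ball, with Möbius addition $$x\oplus_s y=\frac{(1+\frac2{s^2}\langle x,y\rangle+\frac1{s^2}\|y\|^2)\,x+(1-\frac1{s^2}\|x\|^2)\,y}{1+\frac2{s^2}\langle x,y\rangle+\frac1{s^4}\|x\|^2\|y\|^2},$$ distance $d_s(x,y)=2s\tanh^{-1}(\|-x\oplus_s y\|/s)$, scalar multiplication $r\otimes_s x=s\tanh\!\big(r\tanh^{-1}(\|x\|/s)\big)\frac{x}{\|x\|}$, Lorentz factor $\gamma_x=(1-\|x\|^2/s^2)^{-1/2}$, and, for a matrix $\mathbf L\in\mathbb R^{d^t\times d^s}$, the hyperbolic linear layer $$\mathbf L^{\otimes_s}x=s\tanh\!\Big(\tfrac{\|\mathbf Lx\|}{\|x\|}\tanh^{-1}\tfrac{\|x\|}{s}\Big)\frac{\mathbf Lx}{\|\mathbf Lx\|}$$ (both products are $0$ where the direction vector is $0$). Let $C_x,C_y<s$, let $\mu^s,\mu^t$ be probability measures on $\mathbb B_s^{d^s}$, $\mathbb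 B_s^{d^t}$ concentrated on $\{\|x\|\le C_x\}$ and $\{\|y\|\le C_y\}$, let $T^*$ be a transport map from $\mu^s$ to $\mu^t$ (measurable, $T^*_\sharp\mu^s=\mu^t$), and let $\mathbf M_0$ be a coupling of $\mu^s$ and $\mu^t$, with gyrobarycenter map $$B^{\rm H}_{\mathbf M_0}(x)=\tfrac12\otimes_s\frac{\int\gamma_y^2\,y\;\mathbf M_0(dy\mid x)}{\int(\gamma_y^2-\frac12)\,\mathbf M_0(dy\mid x)}.$$ Let $\mathbf x_1,\dots,\mathbf x_n$ be i.i.d. with law $\mu^s$ ($n\ge1$). For target points $\mathbf x^t_1,\dots,\mathbf x^t_m$ with $\|\mathbf x^t_j\|\le C_y$ and a coupling matrix $\hat{\mathbf M}\in\Pi(\mathbf a,\mathbf b)=\{\mathbf M\in\mathbb R_+^{n\times m}:\mathbf M\mathbf 1=\mathbf a,\ \mathbf M^\top\mathbf 1=\mathbf b\}$ of probability vectors $\mathbf a,\mathbf b$ with $\mathbf a_i>0$ for all $i$, let $$B^{\rm H}_{\hat{\mathbf M}}(\mathbf x_i)=\tfrac12\otimes_s\frac{\sum_j\hat{\mathbf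 M}_{ij}\gamma_{\mathbf x_j^t}^2\,\mathbf x_j^t}{\sum_j\hat{\mathbf M}_{ij}(\gamma_{\mathbf x_j^t}^2-\frac12)} .$$ Fix $\omega>0$ and $\mathbf K\in\mathbb R^{d^t\times d^s}$, and call $T=\mathbf L^{\otimes_s}$ learned with $\hat{\mathbf M}$ if $\mathbf L$ minimizes $\frac1n\sum_i d_s(B^{\rm H}_{\hat{\mathbf M}}(\mathbf x_i),\mathbf L^{\otimes_s}\mathbf x_i)+\omega\|\mathbf L-\mathbf K\|_F^2$ over $\mathbb R^{d^t\times d^s}$. Then there is a constant $C$ depending only on $d^s,d^t,s,\omega,\mathbf K,C_x,C_y$ such that, for every $n\ge1$ and $\delta\in(0,1)$, with probability at least $1-\delta$ over the source sample, simultaneously for all such target points, $\mathbf a$, $\mathbf b$, $\hat{\mathbf M}$ and all maps $T$ learned with $\hat{\mathbf M}$, the two expectations below are finite and $$\mathbb E_{x\sim\mu^s}\big[d_s(T(x),T^*(x))\big]\le\frac1n\sum_{i=1}^n d_s\big(T(\mathbf x_i),B^{\rm H}_{\hat{\mathbf M}}(\mathbf x_i)\big)+\frac1n\sum_{i=1}^n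 d_s\big(B^{\rm H}_{\hat{\mathbf M}}(\mathbf x_i),B^{\rm H}_{\mathbf M_0}(\mathbf x_i)\big)+\mathbb E_{x\sim\mu^s}\big[d_s(T^*(x),B^{\rm H}_{\mathbf M_0}(x))\big]+C\,\frac{1+\sqrt{\ln(1/\delta)}}{\sqrt n}.$$ -/

import Mathlib

open MeasureTheory ProbabilityTheory
open scoped Matrix

noncomputable section

namespace HypOT

/-- The ambient Euclidean space `ℝ^d`. The Poincaré ball of radius `s` is `{x | ‖x‖ < s}`. -/
abbrev E (d : ℕ) : Type := EuclideanSpace ℝ (Fin d)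

/-- Möbius addition `x ⊕ₛ y` in the ball of radius `s`. -/
def mobAdd {d : ℕ} (s : ℝ) (x y : E d) : E d :=
  (1 + 2 / s ^ 2 * inner ℝ x y + ‖x‖ ^ 2 * ‖y‖ ^ 2 / s ^ 4)⁻¹ •
    ((1 + 2 / s ^ 2 * inner ℝ x y + ‖y‖ ^ 2 / s ^ 2) • x + (1 - ‖x‖ ^ 2 / s ^ 2) • y)

/-- Poincaré distance `dₛ(x, y) = 2 s artanh (‖(-x) ⊕ₛ y‖ / s)`. -/
def pdist {d : ℕ} (s : ℝ) (x y : E d) : ℝ :=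
  2 * s * Real.artanh (‖mobAdd s (-x) y‖ / s)

/-- Möbius scalar multiplication `r ⊗ₛ x` (equal to `0` at `x = 0`). -/
def mobSMul {d : ℕ} (s r : ℝ) (x : E d) : E d :=
  (s * Real.tanh (r * Real.artanh (‖x‖ / s)) / ‖x‖) • x

/-- The matrix-vector product `L x` on Euclidean spaces. -/
def matVec {dt ds : ℕ} (L : Matrix (Fin dt) (Fin ds) ℝ) (x : E ds) : E dt :=
  WithLp.toLp 2 (L *ᵥ x.ofLp)

/-- The hyperbolic linear layer `x ↦ L^{⊗ₛ} x`, Möbius matrix-vector multiplication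
(equal to `0` where `L x = 0`). -/
def mobLayer {dt ds : ℕ} (s : ℝ) (L : Matrix (Fin dt) (Fin ds) ℝ) (x : E ds) : E dt :=
  (s * Real.tanh (‖matVec L x‖ / ‖x‖ * Real.artanh (‖x‖ / s)) / ‖matVec L x‖) • matVec L x

/-- Lorentz gamma factor `(1 - ‖x‖² / s²)^(-1/2)`. -/
def gammaFactor {d : ℕ} (s : ℝ) (x : E d) : ℝ :=
  (√(1 - ‖x‖ ^ 2 / s ^ 2))⁻¹

/-- The set `Π(a, b)` of discrete couplings of the weight vectors `a` and `b`. -/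
def couplings {n m : ℕ} (a : Fin n → ℝ) (b : Fin m → ℝ) : Set (Matrix (Fin n) (Fin m) ℝ) :=
  {M | (∀ i j, 0 ≤ M i j) ∧ (∀ i, ∑ j, M i j = a i) ∧ ∀ j, ∑ i, M i j = b j}

/-- Empirical gyrobarycenter map: the image of the `i`-th source sample, that is, the `i`-th row of
`(1/2) ⊗ₛ diag(M g)⁻¹ M G Xᵗ` with `g = γ² - 1/2` and `G = diag(γ²)`. -/
def gyroBary {n m d : ℕ} (s : ℝ) (M : Matrix (Fin n) (Fin m) ℝ) (Xt : Fin m → E d)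
    (i : Fin n) : E d :=
  mobSMul s (1 / 2)
    ((∑ j, M i j * (gammaFactor s (Xt j) ^ 2 - 1 / 2))⁻¹ •
      ∑ j, (M i j * gammaFactor s (Xt j) ^ 2) • Xt j)

/-- Population gyrobarycenter map of a coupling `M₀` of two probability measures: the same formula,
with the normalized row of the coupling matrix at a source point `x` replaced by the conditional
law `M₀(· | x)` of the target given the source. -/
def gyroBaryPop {ds dt : ℕ} (s : ℝ) (M₀ : Measure (E ds × E dt)) [IsFiniteMeasure M₀]
    (x : E ds) : E dt :=
  mobSMul s (1 / 2)
    ((∫ y, (gammaFactor s y ^ 2 - 1 / 2) ∂(M₀.condKernel x))⁻¹ •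
      ∫ y, gammaFactor s y ^ 2 • y ∂(M₀.condKernel x))

/-- Fitting term `lᴴ(T, B_M)` plus the regularizer `ω ‖L - K‖_F²`, for `T = L^{⊗ₛ}`. -/
def qualityLoss {n m ds dt : ℕ} (s ω : ℝ) (K : Matrix (Fin dt) (Fin ds) ℝ)
    (X : Fin n → E ds) (Xt : Fin m → E dt) (M : Matrix (Fin n) (Fin m) ℝ)
    (L : Matrix (Fin dt) (Fin ds) ℝ) : ℝ :=
  1 / (n : ℝ) * ∑ i, pdist s (gyroBary s M Xt i) (mobLayer s L (X i))
    + ω * ∑ p, ∑ q, (L p q - K p q) ^ 2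

/-- `L` is learned from the samples with the coupling `M`: it minimizes the quality loss. If `(M, L)`
minimizes that loss plus a term depending on `M` only (the regularized transport loss),
jointly or alternately, then `L` has this property. -/
def IsLearned {n m ds dt : ℕ} (s ω : ℝ) (K : Matrix (Fin dt) (Fin ds) ℝ)
    (X : Fin n → E ds) (Xt : Fin m → E dt) (M : Matrix (Fin n) (Fin m) ℝ)
    (L : Matrix (Fin dt) (Fin ds) ℝ) : Prop :=
  ∀ L' : Matrix (Fin dt) (Fin ds) ℝ, qualityLoss s ω K X Xt M L ≤ qualityLoss s ω K X Xt M L'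

end HypOT

end

noncomputable section

namespace HypOT

/-! Write B₀ for the population gyrobarycenter map and B̂ for the empirical one. The triangle
inequality for `pdist` gives E d(T, T*) ≤ E d(T, B₀) + E d(B₀, T*) under the source law, and d(T,
B₀) ≤ d(T, B̂) + d(B̂, B₀) at each sample point. What remains is to compare the mean of d(T, B₀)
with its sample average, although T depends on the sample.

This is a uniform law of large numbers. Comparing the loss of a learned `L` with that of `K`
confines `L` to a cube around `K` whose size depends on neither the sample, the target points nor
the coupling (`IsLearned.abs_sub_le`). Since B₀ depends only on `M₀`, a single event controlling x ↦
d(L x, B₀ x) for all `L` in this cube serves every target configuration at once.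

On that cube all image points lie in one closed ball of radius below `s`. There `pdist` is bounded
and Euclidean-Lipschitz (`pdist_le`), and the layer is Lipschitz in `L` because it is linear between
the logarithm and exponential maps at the origin (`mobLayer_eq_expZero`, `norm_expZero_sub_le`).
Chaining over dyadic grids, with Hoeffding's inequality for each increment
(`exists_event_uniform_deviation`), then yields the rate 1/√n without a logarithm of n.

The triangle inequality itself comes from the hyperboloid model, where cosh (d / s) is a Lorentz
product and the discriminant of a quadratic form gives the required Cauchy–Schwarz bound. -/

/-! ### Hyperbolic tangent and its inverse -/

theorem hasDerivAt_tanh (x : ℝ) : HasDerivAt Real.tanh (1 / Real.cosh x ^ 2) x := by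
  have h := (Real.hasDerivAt_sinh x).div (Real.hasDerivAt_cosh x) (Real.cosh_pos x).ne'
  have e : Real.tanh = Real.sinh / Real.cosh := by
    funext y; simp [Real.tanh_eq_sinh_div_cosh]
  rw [e]
  rwa [show Real.cosh x * Real.cosh x - Real.sinh x * Real.sinh x = 1 by
    linear_combination Real.cosh_sq x] at h

theorem abs_tanh_sub_tanh_le (a b : ℝ) : |Real.tanh a - Real.tanh b| ≤ |a - b| := by
  have h := Convex.norm_image_sub_le_of_norm_hasDerivWithin_le (C := 1) (s := Set.univ)
    (fun x _ => (hasDerivAt_tanh x).hasDerivWithinAt) (fun x _ => ?_) convex_univ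
    (Set.mem_univ b) (Set.mem_univ a)
  · simpa using h
  · rw [Real.norm_of_nonneg (by positivity), div_le_one (by positivity)]
    exact one_le_pow₀ (Real.one_le_cosh x)

theorem continuous_tanh : Continuous Real.tanh :=
  continuous_iff_continuousAt.2 fun x => (hasDerivAt_tanh x).continuousAt

theorem tanh_mono : Monotone Real.tanh :=
  monotone_of_hasDerivAt_nonneg hasDerivAt_tanh fun x => by positivity

theorem tanh_nonneg {x : ℝ} (hx : 0 ≤ x) : 0 ≤ Real.tanh x := by
  simpa using tanh_mono hx

theorem tanh_le_self {x : ℝ} (hx : 0 ≤ x) : Real.tanh x ≤ x := by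
  have h := abs_tanh_sub_tanh_le x 0
  rwa [Real.tanh_zero, sub_zero, sub_zero, abs_of_nonneg hx, abs_of_nonneg (tanh_nonneg hx)] at h

theorem measurable_artanh : Measurable Real.artanh := by
  unfold Real.artanh
  fun_prop

/-! ### The Poincaré distance: triangle inequality and Euclidean comparison -/

section Geometry

variable {d : ℕ} {s : ℝ}

theorem one_sub_normSq_div_pos {x : E d} (hs : 0 < s) (hx : ‖x‖ < s) :
    0 < 1 - ‖x‖ ^ 2 / s ^ 2 := by
  rw [sub_pos, div_lt_one (by positivity)]
  exact pow_lt_pow_left₀ hx (norm_nonneg x) two_ne_zero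

theorem mobAdd_denom_eq (hs : 0 < s) (x y : E d) :
    1 + 2 / s ^ 2 * inner ℝ (-x) y + ‖-x‖ ^ 2 * ‖y‖ ^ 2 / s ^ 4 =
      ‖x - y‖ ^ 2 / s ^ 2 + (1 - ‖x‖ ^ 2 / s ^ 2) * (1 - ‖y‖ ^ 2 / s ^ 2) := by
  rw [norm_sub_sq_real, inner_neg_left, norm_neg]
  field_simp
  ring

/-- The squared numerator contains the denominator as a factor, which leaves the form q / (q + κ)
with κ > 0. This form shows that the argument of artanh is below 1 and makes the cosh of the
distance rational. -/
theorem normSq_mobAdd_neg (hs : 0 < s) {x y : E d} (hx : ‖x‖ < s) (hy : ‖y‖ < s) :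
    (‖mobAdd s (-x) y‖ / s) ^ 2 = ‖x - y‖ ^ 2 / s ^ 2 /
      (‖x - y‖ ^ 2 / s ^ 2 + (1 - ‖x‖ ^ 2 / s ^ 2) * (1 - ‖y‖ ^ 2 / s ^ 2)) := by
  have hκ := mul_pos (one_sub_normSq_div_pos hs hx) (one_sub_normSq_div_pos hs hy)
  have hD : 0 < ‖x - y‖ ^ 2 / s ^ 2 + (1 - ‖x‖ ^ 2 / s ^ 2) * (1 - ‖y‖ ^ 2 / s ^ 2) := by
    positivity
  have hD' := mobAdd_denom_eq hs x y
  set D := ‖x - y‖ ^ 2 / s ^ 2 + (1 - ‖x‖ ^ 2 / s ^ 2) * (1 - ‖y‖ ^ 2 / s ^ 2) with hDdef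
  rw [mobAdd, hD', norm_smul, div_pow, mul_pow, norm_add_sq_real, norm_smul, norm_smul,
    inner_smul_left, inner_smul_right]
  simp only [norm_inv, Real.norm_eq_abs, mul_pow, sq_abs, inv_pow, conj_trivial, norm_neg,
    inner_neg_left]
  have key : (1 + 2 / s ^ 2 * -inner ℝ x y + ‖y‖ ^ 2 / s ^ 2) ^ 2 * ‖x‖ ^ 2 +
      2 * ((1 + 2 / s ^ 2 * -inner ℝ x y + ‖y‖ ^ 2 / s ^ 2) *
        ((1 - ‖x‖ ^ 2 / s ^ 2) * -inner ℝ x y)) + (1 - ‖x‖ ^ 2 / s ^ 2) ^ 2 * ‖y‖ ^ 2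
      = D * ‖x - y‖ ^ 2 := by
    rw [hDdef, norm_sub_sq_real]
    field_simp
    ring
  rw [key]
  field_simp

theorem mobAdd_neg_mem_Ico (hs : 0 < s) {x y : E d} (hx : ‖x‖ < s) (hy : ‖y‖ < s) :
    ‖mobAdd s (-x) y‖ / s ∈ Set.Ico (0 : ℝ) 1 := by
  have hκ := mul_pos (one_sub_normSq_div_pos hs hx) (one_sub_normSq_div_pos hs hy)
  refine ⟨by positivity, ?_⟩
  rw [← sq_lt_one_iff₀ (by positivity), normSq_mobAdd_neg hs hx hy, div_lt_one (by positivity)]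
  linarith

theorem pdist_nonneg (hs : 0 ≤ s) (x y : E d) : 0 ≤ pdist s x y := by
  unfold pdist
  have := Real.artanh_nonneg (x := ‖mobAdd s (-x) y‖ / s) (by positivity)
  positivity

/-- With t² = q / (q + κ), cosh (2 artanh t) = (1 + t²) / (1 - t²) simplifies to 1 + 2q / κ. -/
theorem cosh_pdist_div (hs : 0 < s) {x y : E d} (hx : ‖x‖ < s) (hy : ‖y‖ < s) :
    Real.cosh (pdist s x y / s) = 1 + 2 * (‖x - y‖ ^ 2 / s ^ 2) /
      ((1 - ‖x‖ ^ 2 / s ^ 2) * (1 - ‖y‖ ^ 2 / s ^ 2)) := by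
  have hκ := mul_pos (one_sub_normSq_div_pos hs hx) (one_sub_normSq_div_pos hs hy)
  obtain ⟨h0, h1⟩ := mobAdd_neg_mem_Ico hs hx hy
  have hsq := normSq_mobAdd_neg hs hx hy
  have hq : 0 ≤ ‖x - y‖ ^ 2 / s ^ 2 := by positivity
  unfold pdist
  generalize ‖mobAdd s (-x) y‖ / s = t at *
  generalize (1 - ‖x‖ ^ 2 / s ^ 2) * (1 - ‖y‖ ^ 2 / s ^ 2) = κ at *
  generalize ‖x - y‖ ^ 2 / s ^ 2 = q at *
  have ht : t ∈ Set.Ioo (-1 : ℝ) 1 := ⟨by linarith, h1⟩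
  have ht2 : 0 < 1 - t ^ 2 := by nlinarith
  rw [show 2 * s * Real.artanh t / s = 2 * Real.artanh t by field_simp, Real.cosh_two_mul,
    Real.cosh_artanh ht, Real.sinh_artanh ht, div_pow, div_pow, Real.sq_sqrt ht2.le, hsq]
  have : 1 - q / (q + κ) = κ / (q + κ) := by field_simp; ring
  rw [this]
  field_simp
  ring

theorem pdist_comm (hs : 0 < s) {x y : E d} (hx : ‖x‖ < s) (hy : ‖y‖ < s) :
    pdist s x y = pdist s y x := by
  have h := (mobAdd_neg_mem_Ico hs hx hy).1
  have h' := (mobAdd_neg_mem_Ico hs hy hx).1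
  have : ‖mobAdd s (-x) y‖ / s = ‖mobAdd s (-y) x‖ / s := by
    rw [← sq_eq_sq₀ h h', normSq_mobAdd_neg hs hx hy, normSq_mobAdd_neg hs hy hx, norm_sub_rev,
      mul_comm (1 - ‖x‖ ^ 2 / s ^ 2)]
  rw [pdist, pdist, this]

/-- The Lorentz form is negative semidefinite on the orthogonal complement of a unit timelike
vector. -/
theorem lorentz_form_nonneg {V : Type*} [NormedAddCommGroup V] [InnerProductSpace ℝ V]
    {x y : V} {x₀ y₀ : ℝ} (hy : y₀ ^ 2 = 1 + ‖y‖ ^ 2) :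
    0 ≤ (x₀ * y₀ - inner ℝ x y) ^ 2 - (x₀ ^ 2 - ‖x‖ ^ 2) := by
  have hcs : inner ℝ x y ^ 2 ≤ ‖x‖ ^ 2 * ‖y‖ ^ 2 := by
    rw [← mul_pow, sq_le_sq, abs_of_nonneg (by positivity : 0 ≤ ‖x‖ * ‖y‖)]
    exact abs_real_inner_le_norm x y
  have e : (x₀ * y₀ - inner ℝ x y) ^ 2 - (x₀ ^ 2 - ‖x‖ ^ 2) =
      ‖y‖ ^ 2 * x₀ ^ 2 - 2 * (y₀ * inner ℝ x y) * x₀ + (‖x‖ ^ 2 + inner ℝ x y ^ 2) := by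
    linear_combination x₀ ^ 2 * hy
  rw [e]
  rcases eq_or_lt_of_le (sq_nonneg ‖y‖) with h | h
  · have : inner ℝ x y = 0 := by
      rw [← h, mul_zero] at hcs
      exact pow_eq_zero_iff two_ne_zero |>.1 (le_antisymm hcs (sq_nonneg _))
    rw [← h, this]
    nlinarith [sq_nonneg ‖x‖]
  -- Multiplied by ‖y‖², the expression is a perfect square plus the Cauchy–Schwarz gap of x and y.
  · refine nonneg_of_mul_nonneg_right ?_ h
    have : ‖y‖ ^ 2 * (‖y‖ ^ 2 * x₀ ^ 2 - 2 * (y₀ * inner ℝ x y) * x₀ +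
        (‖x‖ ^ 2 + inner ℝ x y ^ 2)) = (‖y‖ ^ 2 * x₀ - y₀ * inner ℝ x y) ^ 2 +
        (‖x‖ ^ 2 * ‖y‖ ^ 2 - inner ℝ x y ^ 2) := by
      linear_combination (-inner ℝ x y ^ 2) * hy
    rw [this]
    nlinarith [sq_nonneg (‖y‖ ^ 2 * x₀ - y₀ * inner ℝ x y)]

/-- The form of `lorentz_form_nonneg`, evaluated at x + t z, is a quadratic polynomial in t that is
never negative, so its discriminant is at most 0. -/
theorem lorentz_cauchy_schwarz {V : Type*} [NormedAddCommGroup V] [InnerProductSpace ℝ V]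
    {x y z : V} {x₀ y₀ z₀ : ℝ} (hx : x₀ ^ 2 = 1 + ‖x‖ ^ 2) (hy : y₀ ^ 2 = 1 + ‖y‖ ^ 2)
    (hz : z₀ ^ 2 = 1 + ‖z‖ ^ 2) :
    ((x₀ * z₀ - inner ℝ x z) - (x₀ * y₀ - inner ℝ x y) * (y₀ * z₀ - inner ℝ y z)) ^ 2 ≤
      ((x₀ * y₀ - inner ℝ x y) ^ 2 - 1) * ((y₀ * z₀ - inner ℝ y z) ^ 2 - 1) := by
  have h := discrim_le_zero (a := (y₀ * z₀ - inner ℝ y z) ^ 2 - 1)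
    (b := 2 * ((x₀ * y₀ - inner ℝ x y) * (y₀ * z₀ - inner ℝ y z) - (x₀ * z₀ - inner ℝ x z)))
    (c := (x₀ * y₀ - inner ℝ x y) ^ 2 - 1) (fun t => ?_)
  · unfold discrim at h
    nlinarith
  · have h := lorentz_form_nonneg (x := x + t • z) (x₀ := x₀ + t * z₀) hy
    rw [norm_add_sq_real, norm_smul, mul_pow, Real.norm_eq_abs, sq_abs, inner_smul_right,
      inner_add_left, real_inner_smul_left, real_inner_comm y z] at h
    refine h.trans_eq ?_
    linear_combination (-1 : ℝ) * hx - t ^ 2 * hz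

theorem pdist_triangle (hs : 0 < s) {x y z : E d} (hx : ‖x‖ < s) (hy : ‖y‖ < s) (hz : ‖z‖ < s) :
    pdist s x z ≤ pdist s x y + pdist s y z := by
  -- Lift u to the hyperboloid: with κ = 1 - ‖u‖² / s², the time coordinate is (1 + ‖u‖² / s²) / κ
  -- and the space part is 2u / (sκ).
  have lift_sq : ∀ {u : E d}, ‖u‖ < s →
      ((1 + ‖u‖ ^ 2 / s ^ 2) / (1 - ‖u‖ ^ 2 / s ^ 2)) ^ 2 =
        1 + ‖(2 / (s * (1 - ‖u‖ ^ 2 / s ^ 2))) • u‖ ^ 2 := by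
    intro u hu
    have := one_sub_normSq_div_pos hs hu
    rw [norm_smul, mul_pow, Real.norm_eq_abs, sq_abs]
    have e : ‖u‖ ^ 2 = s ^ 2 * (1 - (1 - ‖u‖ ^ 2 / s ^ 2)) := by field_simp; ring
    generalize 1 - ‖u‖ ^ 2 / s ^ 2 = κ at *
    rw [e]
    field_simp
    ring
  have lift_form : ∀ {u v : E d}, ‖u‖ < s → ‖v‖ < s →
      (1 + ‖u‖ ^ 2 / s ^ 2) / (1 - ‖u‖ ^ 2 / s ^ 2) *
        ((1 + ‖v‖ ^ 2 / s ^ 2) / (1 - ‖v‖ ^ 2 / s ^ 2)) -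
        inner ℝ ((2 / (s * (1 - ‖u‖ ^ 2 / s ^ 2))) • u) ((2 / (s * (1 - ‖v‖ ^ 2 / s ^ 2))) • v) =
      Real.cosh (pdist s u v / s) := by
    intro u v hu hv
    have h1 := one_sub_normSq_div_pos hs hu
    have h2 := one_sub_normSq_div_pos hs hv
    rw [cosh_pdist_div hs hu hv, norm_sub_sq_real, inner_smul_left, inner_smul_right, conj_trivial]
    have e1 : ‖u‖ ^ 2 = s ^ 2 * (1 - (1 - ‖u‖ ^ 2 / s ^ 2)) := by field_simp; ring
    have e2 : ‖v‖ ^ 2 = s ^ 2 * (1 - (1 - ‖v‖ ^ 2 / s ^ 2)) := by field_simp; ring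
    generalize 1 - ‖u‖ ^ 2 / s ^ 2 = κ at *
    generalize 1 - ‖v‖ ^ 2 / s ^ 2 = κ' at *
    rw [e1, e2]
    field_simp
    ring
  have h := lorentz_cauchy_schwarz (lift_sq hx) (lift_sq hy) (lift_sq hz)
  rw [lift_form hx hy, lift_form hy hz, lift_form hx hz] at h
  have ha := div_nonneg (pdist_nonneg hs.le x y) hs.le
  have hb := div_nonneg (pdist_nonneg hs.le y z) hs.le
  have hc := div_nonneg (pdist_nonneg hs.le x z) hs.le
  rw [← div_le_div_iff_of_pos_right hs, add_div]
  generalize pdist s x y / s = α at *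
  generalize pdist s y z / s = β at *
  generalize pdist s x z / s = γ at *
  -- The Lorentz bound is the square of this inequality, and cosh α cosh β + sinh α sinh β = cosh (α
  -- + β).
  have hle : Real.cosh γ - Real.cosh α * Real.cosh β ≤ Real.sinh α * Real.sinh β := by
    refine le_of_sq_le_sq ?_ (mul_nonneg (Real.sinh_nonneg_iff.2 ha) (Real.sinh_nonneg_iff.2 hb))
    rw [mul_pow, Real.sinh_sq, Real.sinh_sq]
    exact h
  have : Real.cosh γ ≤ Real.cosh (α + β) := by rw [Real.cosh_add]; linarith
  rwa [Real.cosh_le_cosh, abs_of_nonneg hc, abs_of_nonneg (by positivity)] at this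

/-- Lipschitz constant of the Poincaré distance against the Euclidean one on the ball of
radius `ρ < s`. -/
def pdistLip (s ρ : ℝ) : ℝ := 20 / (1 - ρ ^ 2 / s ^ 2) ^ 3

theorem one_sub_sq_div_mem {ρ : ℝ} (hs : 0 < s) (h0 : 0 ≤ ρ) (hρ : ρ < s) :
    1 - ρ ^ 2 / s ^ 2 ∈ Set.Ioc (0 : ℝ) 1 := by
  constructor
  · rw [sub_pos, div_lt_one (by positivity)]
    exact pow_lt_pow_left₀ hρ h0 two_ne_zero
  · rw [sub_le_self_iff]
    positivity

theorem pdistLip_pos {ρ : ℝ} (hs : 0 < s) (h0 : 0 ≤ ρ) (hρ : ρ < s) : 0 < pdistLip s ρ := by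
  have := (one_sub_sq_div_mem hs h0 hρ).1
  unfold pdistLip
  positivity

theorem artanh_le {t : ℝ} (h0 : 0 ≤ t) (h1 : t < 1) : Real.artanh t ≤ 2 * t / (1 - t ^ 2) := by
  have h2 : 0 < 1 - t ^ 2 := by nlinarith
  have h3 : 0 < 1 - t := by linarith
  rw [Real.artanh_eq_half_log ⟨by linarith, h1.le⟩]
  have := Real.log_le_sub_one_of_pos (x := (1 + t) / (1 - t)) (by positivity)
  have e : (1 + t) / (1 - t) - 1 = 2 * (t / (1 - t)) := by field_simp; ring
  have : t / (1 - t) ≤ 2 * t / (1 - t ^ 2) := by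
    rw [div_le_div_iff₀ h3 h2]
    nlinarith [mul_nonneg h0 (mul_nonneg h3.le h3.le)]
  linarith

theorem pdist_le {ρ : ℝ} (hs : 0 < s) (h0 : 0 ≤ ρ) (hρ : ρ < s) {x y : E d} (hx : ‖x‖ ≤ ρ)
    (hy : ‖y‖ ≤ ρ) : pdist s x y ≤ pdistLip s ρ * ‖x - y‖ := by
  obtain ⟨hκ, hκ1⟩ := one_sub_sq_div_mem hs h0 hρ
  have mono : ∀ {u : E d}, ‖u‖ ≤ ρ → 1 - ρ ^ 2 / s ^ 2 ≤ 1 - ‖u‖ ^ 2 / s ^ 2 := by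
    intro u hu
    gcongr
  have hprod : (1 - ρ ^ 2 / s ^ 2) ^ 2 ≤ (1 - ‖x‖ ^ 2 / s ^ 2) * (1 - ‖y‖ ^ 2 / s ^ 2) := by
    rw [sq]
    exact mul_le_mul (mono hx) (mono hy) hκ.le (hκ.le.trans (mono hx))
  have hxs := hx.trans_lt hρ
  have hys := hy.trans_lt hρ
  obtain ⟨ht0, ht1⟩ := mobAdd_neg_mem_Ico hs hxs hys
  have hsq := normSq_mobAdd_neg hs hxs hys
  have hr : 0 ≤ ‖x - y‖ / s := by positivity
  have hr2 : ‖x - y‖ / s ≤ 2 := by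
    rw [div_le_iff₀ hs]
    linarith [norm_sub_le x y]
  rw [← div_pow] at hsq
  have hgoal : pdistLip s ρ * ‖x - y‖ = s * (pdistLip s ρ * (‖x - y‖ / s)) := by field_simp
  rw [hgoal, pdist, pdistLip]
  generalize ‖x - y‖ / s = r at *
  generalize ‖mobAdd s (-x) y‖ / s = t at *
  generalize (1 - ‖x‖ ^ 2 / s ^ 2) * (1 - ‖y‖ ^ 2 / s ^ 2) = P at *
  generalize 1 - ρ ^ 2 / s ^ 2 = κ at *
  have hP : 0 < P := lt_of_lt_of_le (by positivity) hprod
  have hD : 0 < r ^ 2 + P := by positivity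
  have ht2 : 1 - t ^ 2 = P / (r ^ 2 + P) := by rw [hsq]; field_simp; ring
  have htr : t ≤ r / κ := by
    refine le_of_sq_le_sq ?_ (by positivity)
    rw [hsq, div_pow]
    gcongr
    nlinarith [sq_nonneg r]
  -- 1 / (1 - t²) = 1 + r² / P with r ≤ 2, P ≥ κ² and κ ≤ 1. Together with t ≤ r / κ this gives the
  -- 2 · 2 · 5 = 20 and the cube in `pdistLip`.
  have hinv : 1 / (1 - t ^ 2) ≤ 5 / κ ^ 2 := by
    rw [ht2, one_div_div, div_le_div_iff₀ hP (by positivity)]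
    have : r ^ 2 ≤ 4 := by nlinarith
    have : κ ^ 2 ≤ 1 := by nlinarith
    nlinarith
  calc 2 * s * Real.artanh t ≤ 2 * s * (2 * (t * (1 / (1 - t ^ 2)))) := by
        have := artanh_le ht0 ht1
        have e : 2 * (t * (1 / (1 - t ^ 2))) = 2 * t / (1 - t ^ 2) := by ring
        rw [e]; gcongr
    _ ≤ 2 * s * (2 * (r / κ * (5 / κ ^ 2))) := by
        have h0 : 0 ≤ 1 / (1 - t ^ 2) := by rw [ht2]; positivity
        exact mul_le_mul_of_nonneg_left (mul_le_mul_of_nonneg_left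
          (mul_le_mul htr hinv h0 (by positivity)) zero_le_two) (by positivity)
    _ = s * (20 / κ ^ 3 * r) := by field_simp; ring

theorem pdist_le_const {ρ : ℝ} (hs : 0 < s) (h0 : 0 ≤ ρ) (hρ : ρ < s) {x y : E d} (hx : ‖x‖ ≤ ρ)
    (hy : ‖y‖ ≤ ρ) : pdist s x y ≤ pdistLip s ρ * (2 * ρ) := by
  refine (pdist_le hs h0 hρ hx hy).trans ?_
  have := pdistLip_pos hs h0 hρ
  gcongr
  linarith [norm_sub_le x y]

theorem measurable_pdist (s : ℝ) : Measurable fun p : E d × E d => pdist s p.1 p.2 := by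
  have h : Measurable fun p : E d × E d => ‖mobAdd s (-p.1) p.2‖ / s := by
    unfold mobAdd
    fun_prop
  unfold pdist
  have h' := (measurable_artanh.comp h).const_mul (2 * s)
  exact h'

end Geometry

/-! ### The hyperbolic layer through the tangent space at the origin -/

section Layer

variable {ds dt d : ℕ} {s : ℝ}

/-- The map `v ↦ s tanh ‖v‖ v / ‖v‖` from the tangent space at the origin to the ball. -/
def expZero (s : ℝ) (v : E d) : E d := (s * Real.tanh ‖v‖) • (‖v‖⁻¹ • v)

/-- The inverse of `expZero` on the ball. -/
def logZero (s : ℝ) (x : E d) : E d := (Real.artanh (‖x‖ / s) / ‖x‖) • x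

/-- The Frobenius norm of a real matrix. -/
def frob (L : Matrix (Fin dt) (Fin ds) ℝ) : ℝ := √(∑ p, ∑ q, L p q ^ 2)

theorem matVec_smul (L : Matrix (Fin dt) (Fin ds) ℝ) (c : ℝ) (x : E ds) :
    matVec L (c • x) = c • matVec L x := by
  simp [matVec, Matrix.mulVec_smul]

theorem matVec_sub (L L' : Matrix (Fin dt) (Fin ds) ℝ) (x : E ds) :
    matVec L x - matVec L' x = matVec (L - L') x := by
  simp [matVec, Matrix.sub_mulVec]

theorem norm_matVec_le (L : Matrix (Fin dt) (Fin ds) ℝ) (x : E ds) :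
    ‖matVec L x‖ ≤ frob L * ‖x‖ := by
  rw [EuclideanSpace.norm_eq, EuclideanSpace.norm_eq x, frob,
    ← Real.sqrt_mul (by positivity), Finset.sum_mul]
  refine Real.sqrt_le_sqrt (Finset.sum_le_sum fun p _ => ?_)
  simp only [matVec, Real.norm_eq_abs, sq_abs, Matrix.mulVec, dotProduct]
  exact Finset.sum_mul_sq_le_sq_mul_sq _ _ _

theorem frob_le_of_forall_abs_le {L : Matrix (Fin dt) (Fin ds) ℝ} {ε : ℝ} (hε : 0 ≤ ε)
    (h : ∀ p q, |L p q| ≤ ε) : frob L ≤ √((dt : ℝ) * ds) * ε := by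
  have e : √((dt : ℝ) * ds) * ε = √((dt : ℝ) * ds * ε ^ 2) := by
    rw [Real.sqrt_mul (x := (dt : ℝ) * ds) (by positivity), Real.sqrt_sq hε]
  rw [frob, e]
  refine Real.sqrt_le_sqrt ?_
  calc ∑ p, ∑ q, L p q ^ 2 ≤ ∑ _p : Fin dt, ∑ _q : Fin ds, ε ^ 2 :=
        Finset.sum_le_sum fun p _ => Finset.sum_le_sum fun q _ => by
          rw [← sq_abs]; exact pow_le_pow_left₀ (abs_nonneg _) (h p q) 2
    _ = (dt : ℝ) * ds * ε ^ 2 := by simp [mul_assoc]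

theorem norm_unit_le (v : E d) : ‖‖v‖⁻¹ • v‖ ≤ 1 := by
  rw [norm_smul, norm_inv, norm_norm]
  exact inv_mul_le_one

theorem norm_smul_unit (v : E d) : ‖v‖ • (‖v‖⁻¹ • v) = v := by
  by_cases h : v = 0
  · simp [h]
  · rw [smul_smul, mul_inv_cancel₀ (norm_ne_zero_iff.2 h), one_smul]

theorem norm_expZero_le (hs : 0 ≤ s) (v : E d) : ‖expZero s v‖ ≤ s * Real.tanh ‖v‖ := by
  have h := tanh_nonneg (norm_nonneg v)
  rw [expZero, norm_smul, Real.norm_of_nonneg (by positivity)]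
  exact mul_le_of_le_one_right (by positivity) (norm_unit_le v)

/-- Split the difference into a radial and an angular part. The radial part costs s because tanh is
1-Lipschitz. The angular part costs 2s: tanh ‖v‖ ≤ ‖v‖ absorbs the singularity of the direction v /
‖v‖ at the origin. -/
theorem norm_expZero_sub_le (hs : 0 ≤ s) (u v : E d) :
    ‖expZero s u - expZero s v‖ ≤ 3 * s * ‖u - v‖ := by
  set û := ‖u‖⁻¹ • u with hu
  set v' := ‖v‖⁻¹ • v with hv
  have e : expZero s u - expZero s v =
      (s * (Real.tanh ‖u‖ - Real.tanh ‖v‖)) • û + (s * Real.tanh ‖v‖) • (û - v') := by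
    rw [expZero, expZero, ← hu, ← hv]
    module
  have h1 : ‖(s * (Real.tanh ‖u‖ - Real.tanh ‖v‖)) • û‖ ≤ s * ‖u - v‖ := by
    rw [norm_smul, norm_mul, Real.norm_of_nonneg hs, Real.norm_eq_abs]
    calc s * |Real.tanh ‖u‖ - Real.tanh ‖v‖| * ‖û‖ ≤ s * ‖u - v‖ * 1 := by
          refine mul_le_mul (mul_le_mul_of_nonneg_left ?_ hs) (norm_unit_le u) (norm_nonneg _)
            (by positivity)
          exact (abs_tanh_sub_tanh_le _ _).trans (abs_norm_sub_norm_le u v)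
      _ = s * ‖u - v‖ := mul_one _
  have h2 : ‖v‖ * ‖û - v'‖ ≤ 2 * ‖u - v‖ := by
    have e2 : ‖v‖ • (û - v') = (‖v‖ - ‖u‖) • û + (u - v) := by
      have hu' : ‖u‖ • û = u := norm_smul_unit u
      have hv' : ‖v‖ • v' = v := norm_smul_unit v
      rw [smul_sub, sub_smul, hu', hv']
      abel
    have e3 : ‖v‖ * ‖û - v'‖ = ‖‖v‖ • (û - v')‖ := by rw [norm_smul, norm_norm]
    rw [e3, e2]
    refine (norm_add_le _ _).trans ?_
    rw [norm_smul, Real.norm_eq_abs]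
    have := abs_norm_sub_norm_le v u
    rw [norm_sub_rev] at this
    have : |‖v‖ - ‖u‖| * ‖û‖ ≤ ‖u - v‖ * 1 :=
      mul_le_mul this (norm_unit_le u) (norm_nonneg _) (norm_nonneg _)
    linarith
  have h3 : ‖(s * Real.tanh ‖v‖) • (û - v')‖ ≤ s * (2 * ‖u - v‖) := by
    have h0 := tanh_nonneg (norm_nonneg v)
    rw [norm_smul, Real.norm_of_nonneg (by positivity), mul_assoc]
    refine mul_le_mul_of_nonneg_left (le_trans ?_ h2) hs
    exact mul_le_mul_of_nonneg_right (tanh_le_self (norm_nonneg v)) (norm_nonneg _)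
  rw [e]
  refine (norm_add_le _ _).trans ?_
  linarith

theorem mobLayer_eq_expZero (hs : 0 < s) (L : Matrix (Fin dt) (Fin ds) ℝ) (x : E ds) :
    mobLayer s L x = expZero s (matVec L (logZero s x)) := by
  have hA : 0 ≤ Real.artanh (‖x‖ / s) := Real.artanh_nonneg (by positivity)
  have hc : 0 ≤ Real.artanh (‖x‖ / s) / ‖x‖ := by positivity
  rw [logZero, matVec_smul, mobLayer, expZero, norm_smul, Real.norm_of_nonneg hc,
    show ‖matVec L x‖ / ‖x‖ * Real.artanh (‖x‖ / s) =
      Real.artanh (‖x‖ / s) / ‖x‖ * ‖matVec L x‖ by ring]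
  generalize Real.artanh (‖x‖ / s) / ‖x‖ = c at *
  -- A zero factor occurs in particular at x = 0; a positive factor cancels from the direction.
  rcases hc.eq_or_lt with rfl | hc
  · simp
  · rw [smul_smul, smul_smul]
    congr 1
    field_simp

theorem norm_logZero_le {ρ : ℝ} (hs : 0 < s) (hρ : ρ < s) {x : E d} (hx : ‖x‖ ≤ ρ) :
    ‖logZero s x‖ ≤ Real.artanh (ρ / s) := by
  have hA : 0 ≤ Real.artanh (‖x‖ / s) := Real.artanh_nonneg (by positivity)
  have h1 : ‖logZero s x‖ ≤ Real.artanh (‖x‖ / s) := by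
    rw [logZero, norm_smul, Real.norm_of_nonneg (by positivity)]
    rw [div_mul_eq_mul_div]
    exact div_le_of_le_mul₀ (norm_nonneg _) hA le_rfl
  refine h1.trans (Real.artanh_le_artanh ?_ ((div_lt_one hs).2 hρ) (by gcongr))
  have : 0 ≤ ‖x‖ / s := by positivity
  linarith

theorem norm_mobLayer_le {ρ F : ℝ} (hs : 0 < s) (hρ : ρ < s) {L : Matrix (Fin dt) (Fin ds) ℝ}
    (hL : frob L ≤ F) {x : E ds} (hx : ‖x‖ ≤ ρ) :
    ‖mobLayer s L x‖ ≤ s * Real.tanh (F * Real.artanh (ρ / s)) := by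
  rw [mobLayer_eq_expZero hs]
  refine (norm_expZero_le hs.le _).trans (mul_le_mul_of_nonneg_left (tanh_mono ?_) hs.le)
  exact (norm_matVec_le _ _).trans (mul_le_mul hL (norm_logZero_le hs hρ hx) (norm_nonneg _)
    ((Real.sqrt_nonneg _).trans hL))

theorem norm_mobLayer_sub_le {ρ : ℝ} (hs : 0 < s) (hρ : ρ < s)
    (L L' : Matrix (Fin dt) (Fin ds) ℝ) {x : E ds} (hx : ‖x‖ ≤ ρ) :
    ‖mobLayer s L x - mobLayer s L' x‖ ≤ 3 * s * (frob (L - L') * Real.artanh (ρ / s)) := by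
  rw [mobLayer_eq_expZero hs, mobLayer_eq_expZero hs]
  refine (norm_expZero_sub_le hs.le _ _).trans (mul_le_mul_of_nonneg_left ?_ (by positivity))
  rw [matVec_sub]
  exact (norm_matVec_le _ _).trans (mul_le_mul_of_nonneg_left (norm_logZero_le hs hρ hx)
    (Real.sqrt_nonneg _))

theorem measurable_matVec (L : Matrix (Fin dt) (Fin ds) ℝ) :
    Measurable (matVec L : E ds → E dt) := by
  have h : Continuous (matVec L : E ds → E dt) := by
    unfold matVec
    fun_prop
  exact h.measurable

theorem measurable_mobLayer (s : ℝ) (L : Matrix (Fin dt) (Fin ds) ℝ) :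
    Measurable (mobLayer s L : E ds → E dt) := by
  have hL := measurable_matVec L
  have hA : Measurable fun x : E ds => Real.artanh (‖x‖ / s) :=
    measurable_artanh.comp (by fun_prop)
  have hT : Measurable fun x : E ds =>
      Real.tanh (‖matVec L x‖ / ‖x‖ * Real.artanh (‖x‖ / s)) :=
    continuous_tanh.measurable.comp (by fun_prop)
  unfold mobLayer
  fun_prop

theorem measurable_mobSMul (s r : ℝ) : Measurable (mobSMul s r : E d → E d) := by
  have hA : Measurable fun x : E d => Real.artanh (‖x‖ / s) :=
    measurable_artanh.comp (by fun_prop)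
  have hT : Measurable fun x : E d => Real.tanh (r * Real.artanh (‖x‖ / s)) :=
    continuous_tanh.measurable.comp (by fun_prop)
  unfold mobSMul
  fun_prop

end Layer

/-! ### Gyrobarycenters stay in a smaller ball -/

section Barycenter

variable {ds dt d : ℕ} {s C : ℝ}

/-- Radius of a ball around the origin that contains all gyrobarycenters of points in the ball of
radius `C`. -/
def baryRadius (s C : ℝ) : ℝ := 2 * s ^ 2 * C / (s ^ 2 + C ^ 2)

theorem baryRadius_nonneg (h0 : 0 ≤ C) : 0 ≤ baryRadius s C := by
  unfold baryRadius; positivity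

theorem baryRadius_lt (hs : 0 < s) (hC : C < s) : baryRadius s C < s := by
  rw [baryRadius, div_lt_iff₀ (by positivity)]
  have : 0 < s * (s - C) ^ 2 := by
    have := sub_pos.2 hC
    positivity
  nlinarith

theorem gammaFactor_sq (hs : 0 < s) {y : E d} (hy : ‖y‖ < s) :
    gammaFactor s y ^ 2 = (1 - ‖y‖ ^ 2 / s ^ 2)⁻¹ := by
  rw [gammaFactor, inv_pow, Real.sq_sqrt (one_sub_normSq_div_pos hs hy).le]

theorem one_le_gammaFactor_sq (hs : 0 < s) {y : E d} (hy : ‖y‖ < s) :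
    1 ≤ gammaFactor s y ^ 2 := by
  rw [gammaFactor_sq hs hy, one_le_inv₀ (one_sub_normSq_div_pos hs hy), sub_le_self_iff]
  positivity

theorem gammaFactor_sq_le (hs : 0 < s) (hC : C < s) {y : E d} (hy : ‖y‖ ≤ C) :
    gammaFactor s y ^ 2 ≤ (1 - C ^ 2 / s ^ 2)⁻¹ := by
  rw [gammaFactor_sq hs (hy.trans_lt hC)]
  have := (one_sub_sq_div_mem hs ((norm_nonneg y).trans hy) hC).1
  gcongr

/-- The ratio γ²r / (γ² - 1/2) equals 2s²r / (s² + r²), which increases for r < s, so its maximum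
over r ≤ C is `baryRadius s C`. In this product form the bound survives averaging against any
nonnegative weights or conditional law. -/
theorem norm_gammaFactor_sq_smul_le (hs : 0 < s) (hC : C < s) {y : E d} (hy : ‖y‖ ≤ C) :
    ‖gammaFactor s y ^ 2 • y‖ ≤ baryRadius s C * (gammaFactor s y ^ 2 - 1 / 2) := by
  have hys := hy.trans_lt hC
  have h0 := norm_nonneg y
  rw [norm_smul, Real.norm_of_nonneg (by positivity), gammaFactor_sq hs hys, baryRadius]
  have hpos := one_sub_normSq_div_pos hs hys
  have hlt : 0 < s ^ 2 - ‖y‖ ^ 2 := by nlinarith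
  have e : (1 - ‖y‖ ^ 2 / s ^ 2)⁻¹ = s ^ 2 / (s ^ 2 - ‖y‖ ^ 2) := by field_simp
  rw [e]
  generalize ‖y‖ = r at *
  have e1 : s ^ 2 / (s ^ 2 - r ^ 2) * r = s ^ 2 * r / (s ^ 2 - r ^ 2) := by ring
  have e2 : 2 * s ^ 2 * C / (s ^ 2 + C ^ 2) * (s ^ 2 / (s ^ 2 - r ^ 2) - 1 / 2) =
      s ^ 2 * C * (s ^ 2 + r ^ 2) / (s ^ 2 + C ^ 2) / (s ^ 2 - r ^ 2) := by
    field_simp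
    ring
  rw [e1, e2]
  gcongr
  rw [le_div_iff₀ (by positivity)]
  have h1 : 0 ≤ (C - r) * (s ^ 2 - r * C) := by
    refine mul_nonneg (by linarith) ?_
    nlinarith
  nlinarith [mul_nonneg (sq_nonneg s) h1]

/-- This crude bound is enough, since `baryRadius s C` is already below `s`. -/
theorem norm_mobSMul_half_le (hs : 0 < s) {v : E d} (hv : ‖v‖ < s) :
    ‖mobSMul s (1 / 2) v‖ ≤ ‖v‖ := by
  have hA : 0 ≤ Real.artanh (‖v‖ / s) := Real.artanh_nonneg (by positivity)
  have h1 : Real.tanh (1 / 2 * Real.artanh (‖v‖ / s)) ≤ ‖v‖ / s := by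
    have h0 : 0 ≤ ‖v‖ / s := by positivity
    calc Real.tanh (1 / 2 * Real.artanh (‖v‖ / s)) ≤ Real.tanh (Real.artanh (‖v‖ / s)) :=
          tanh_mono (by linarith)
      _ = ‖v‖ / s := Real.tanh_artanh ⟨by linarith, (div_lt_one hs).2 hv⟩
  have h2 : 0 ≤ Real.tanh (1 / 2 * Real.artanh (‖v‖ / s)) := tanh_nonneg (by positivity)
  rw [mobSMul, norm_smul, Real.norm_of_nonneg (by positivity)]
  refine mul_le_of_le_one_left (norm_nonneg v) (div_le_one_of_le₀ ?_ (norm_nonneg v))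
  rwa [le_div_iff₀ hs, mul_comm] at h1

theorem norm_inv_smul_le {V D : ℝ} {v : E d} (hD : 0 ≤ D) (hV : 0 ≤ V) (h : ‖v‖ ≤ V * D) :
    ‖D⁻¹ • v‖ ≤ V := by
  rw [norm_smul, norm_inv, Real.norm_of_nonneg hD, inv_mul_eq_div]
  exact div_le_of_le_mul₀ hD hV h

theorem norm_gyroBary_le {n m : ℕ} (hs : 0 < s) (h0 : 0 ≤ C) (hC : C < s)
    {M : Matrix (Fin n) (Fin m) ℝ} (hM : ∀ i j, 0 ≤ M i j) {Xt : Fin m → E d}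
    (hX : ∀ j, ‖Xt j‖ ≤ C) (i : Fin n) : ‖gyroBary s M Xt i‖ ≤ baryRadius s C := by
  have hv : ‖(∑ j, M i j * (gammaFactor s (Xt j) ^ 2 - 1 / 2))⁻¹ •
      ∑ j, (M i j * gammaFactor s (Xt j) ^ 2) • Xt j‖ ≤ baryRadius s C := by
    refine norm_inv_smul_le (Finset.sum_nonneg fun j _ => mul_nonneg (hM i j) ?_)
      (baryRadius_nonneg h0) ?_
    · linarith [one_le_gammaFactor_sq hs ((hX j).trans_lt hC)]
    · rw [Finset.mul_sum]
      refine norm_sum_le_of_le _ fun j _ => ?_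
      rw [mul_smul, norm_smul, Real.norm_of_nonneg (hM i j), mul_left_comm]
      exact mul_le_mul_of_nonneg_left (norm_gammaFactor_sq_smul_le hs hC (hX j)) (hM i j)
  exact (norm_mobSMul_half_le hs (hv.trans_lt (baryRadius_lt hs hC))).trans hv

theorem measurable_gammaFactor (s : ℝ) : Measurable (gammaFactor s : E d → ℝ) := by
  unfold gammaFactor
  fun_prop

variable (M₀ : Measure (E ds × E dt)) [IsProbabilityMeasure M₀]

theorem measurable_gyroBaryPop : Measurable (gyroBaryPop s M₀) := by
  have hγ : Measurable (gammaFactor s : E dt → ℝ) := measurable_gammaFactor s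
  have h1 : Measurable fun x : E ds =>
      ∫ y, (gammaFactor s y ^ 2 - 1 / 2) ∂(M₀.condKernel x) :=
    (StronglyMeasurable.integral_kernel
      (by fun_prop : Measurable fun y : E dt => gammaFactor s y ^ 2 - 1 / 2).stronglyMeasurable).measurable
  have h2 : Measurable fun x : E ds => ∫ y, gammaFactor s y ^ 2 • y ∂(M₀.condKernel x) :=
    (StronglyMeasurable.integral_kernel
      (by fun_prop : Measurable fun y : E dt => gammaFactor s y ^ 2 • y).stronglyMeasurable).measurable
  exact (measurable_mobSMul s (1 / 2)).comp (h1.inv.smul h2)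

variable {M₀}

theorem norm_gyroBaryPop_le_of_ae (hs : 0 < s) (h0 : 0 ≤ C) (hC : C < s) {x : E ds}
    (hx : ∀ᵐ y ∂(M₀.condKernel x), ‖y‖ ≤ C) : ‖gyroBaryPop s M₀ x‖ ≤ baryRadius s C := by
  have hγ : Measurable (gammaFactor s : E dt → ℝ) := measurable_gammaFactor s
  have hint : Integrable (fun y => gammaFactor s y ^ 2 - 1 / 2) (M₀.condKernel x) := by
    refine Integrable.of_bound (by fun_prop) ((1 - C ^ 2 / s ^ 2)⁻¹) ?_
    filter_upwards [hx] with y hy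
    have h1 := one_le_gammaFactor_sq hs (hy.trans_lt hC)
    rw [Real.norm_of_nonneg (by linarith)]
    linarith [gammaFactor_sq_le hs hC hy]
  have hv : ‖(∫ y, (gammaFactor s y ^ 2 - 1 / 2) ∂(M₀.condKernel x))⁻¹ •
      ∫ y, gammaFactor s y ^ 2 • y ∂(M₀.condKernel x)‖ ≤ baryRadius s C := by
    refine norm_inv_smul_le (integral_nonneg_of_ae ?_) (baryRadius_nonneg h0) ?_
    · filter_upwards [hx] with y hy
      have := one_le_gammaFactor_sq hs (hy.trans_lt hC)
      simp only [Pi.zero_apply]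
      linarith
    · rw [← integral_const_mul]
      refine norm_integral_le_of_norm_le (hint.const_mul _) ?_
      filter_upwards [hx] with y hy using norm_gammaFactor_sq_smul_le hs hC hy
  exact (norm_mobSMul_half_le hs (hv.trans_lt (baryRadius_lt hs hC))).trans hv

theorem ae_norm_gyroBaryPop_le (hs : 0 < s) (h0 : 0 ≤ C) (hC : C < s)
    (hM : ∀ᵐ y ∂M₀.snd, ‖y‖ ≤ C) : ∀ᵐ x ∂M₀.fst, ‖gyroBaryPop s M₀ x‖ ≤ baryRadius s C := by
  have h1 : ∀ᵐ p ∂M₀, ‖p.2‖ ≤ C := by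
    rw [Measure.snd] at hM
    exact ae_of_ae_map measurable_snd.aemeasurable hM
  -- By disintegration, almost every conditional law is carried by the target ball.
  rw [← M₀.disintegrate M₀.condKernel] at h1
  filter_upwards [Measure.ae_ae_of_ae_compProd h1] with x hx
  exact norm_gyroBaryPop_le_of_ae hs h0 hC hx

end Barycenter

/-! ### Hoeffding's inequality and chaining over dyadic grids -/

section Chaining

variable {Ω : Type*} [MeasurableSpace Ω] {μ : Measure Ω} [IsProbabilityMeasure μ]

theorem measureReal_hoeffding_le {h : Ω → ℝ} (hm : Measurable h) {c : ℝ} (hc : 0 ≤ c)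
    (hb : ∀ x, |h x| ≤ c) {n : ℕ} (hn : 0 < n) {u : ℝ} (hu : 0 ≤ u) :
    (Measure.pi fun _ : Fin n => μ).real
      {X | c * √(2 * u / n) < ∫ x, h x ∂μ - 1 / (n : ℝ) * ∑ i, h (X i)} ≤ Real.exp (-u) := by
  have hn' : (0 : ℝ) < n := by exact_mod_cast hn
  rcases hc.eq_or_lt with rfl | hc
  · have : ∀ x, h x = 0 := fun x => abs_nonpos_iff.1 (hb x)
    simp [this, Real.exp_nonneg]
  -- The deviation is mean minus average, so the upper tail bound is applied to the negated
  -- function. Its sub-Gaussian parameter is c², which turns the threshold c √(2u / n) into the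
  -- exponent -u.
  set g : Ω → ℝ := fun x => -h x with hg
  have hgm : Measurable g := hm.neg
  have hsub : HasSubgaussianMGF (fun x => g x - μ[g]) ((‖c - -c‖₊ / 2) ^ 2) μ :=
    hasSubgaussianMGF_of_mem_Icc hgm.aemeasurable (.of_forall fun x => by
      have := abs_le.1 (hb x)
      exact ⟨by simp only [hg]; linarith, by simp only [hg]; linarith⟩)
  have hindep : iIndepFun (fun (i : Fin n) (X : Fin n → Ω) => g (X i) - μ[g])
      (Measure.pi fun _ : Fin n => μ) :=
    iIndepFun_pi (X := fun _ x => g x - μ[g]) fun i => (hgm.sub_const _).aemeasurable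
  have hsub' : ∀ i ∈ (Finset.univ : Finset (Fin n)),
      HasSubgaussianMGF (fun X : Fin n → Ω => g (X i) - μ[g]) ((‖c - -c‖₊ / 2) ^ 2)
        (Measure.pi fun _ : Fin n => μ) := by
    intro i _
    refine HasSubgaussianMGF.of_map (Y := fun X : Fin n → Ω => X i)
      (X := fun x => g x - μ[g]) (measurable_pi_apply i).aemeasurable ?_
    rwa [(measurePreserving_eval (fun _ : Fin n => μ) i).map_eq]
  have key := HasSubgaussianMGF.measure_sum_ge_le_of_iIndepFun hindep hsub'
    (ε := n * (c * √(2 * u / n))) (by positivity)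
  have hcc : ((‖c - -c‖₊ / 2 : NNReal) : ℝ) = c := by
    simp only [NNReal.coe_div, coe_nnnorm, NNReal.coe_ofNat]
    rw [Real.norm_of_nonneg (by linarith)]
    ring
  have hexp : -(n * (c * √(2 * u / n))) ^ 2 /
      (2 * ∑ _i : Fin n, (((‖c - -c‖₊ / 2) ^ 2 : NNReal) : ℝ)) = -u := by
    rw [NNReal.coe_pow, hcc, mul_pow, mul_pow, Real.sq_sqrt (by positivity)]
    simp only [Finset.sum_const, Finset.card_univ, Fintype.card_fin, nsmul_eq_mul]
    field_simp
  push_cast at key hexp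
  rw [hexp] at key
  refine le_trans (measureReal_mono fun X hX => ?_) key
  simp only [Set.mem_ofPred_eq, Finset.sum_sub_distrib, Finset.sum_const, Finset.card_univ,
    Fintype.card_fin, nsmul_eq_mul, hg, integral_neg, Finset.sum_neg_distrib] at hX ⊢
  have := mul_le_mul_of_nonneg_left hX.le hn'.le
  refine this.trans (le_of_eq ?_)
  field_simp
  ring

/-- Simultaneous deviation bounds for a sequence of finite families of functions whose sizes grow
and whose ranges shrink geometrically. -/
theorem exists_event_forall_level {J : ℕ → Type*} [∀ k, Fintype (J k)] {b c : ℝ}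
    (hb : 0 ≤ b) (hc : 0 ≤ c) (hJ : ∀ k, (Fintype.card (J k) : ℝ) ≤ Real.exp ((k + 1) * b))
    {h : ∀ k, J k → Ω → ℝ} (hm : ∀ k j, Measurable (h k j))
    (hbd : ∀ k j x, |h k j x| ≤ c * (1 / 2) ^ k) {n : ℕ} (hn : 0 < n) {δ : ℝ} (h0 : 0 < δ)
    (h1 : δ < 1) :
    ∃ G : Set (Fin n → Ω), MeasurableSet G ∧
      ENNReal.ofReal (1 - δ) ≤ Measure.pi (fun _ : Fin n => μ) G ∧
      ∀ X ∈ G, ∀ k j, ∫ x, h k j x ∂μ - 1 / (n : ℝ) * ∑ i, h k j (X i) ≤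
        c * (1 / 2) ^ k * √(2 * (Real.log (1 / δ) + (k + 1) * (b + 1)) / n) := by
  set P := Measure.pi fun _ : Fin n => μ
  set bad : ∀ k, J k → Set (Fin n → Ω) := fun k j =>
    {X | c * (1 / 2) ^ k * √(2 * (Real.log (1 / δ) + (k + 1) * (b + 1)) / n) <
      ∫ x, h k j x ∂μ - 1 / (n : ℝ) * ∑ i, h k j (X i)} with hbad
  have hmeas : ∀ k j, MeasurableSet (bad k j) := by
    intro k j
    have : Measurable fun X : Fin n → Ω => ∑ i, h k j (X i) :=
      Finset.measurable_sum _ fun i _ => (hm k j).comp (measurable_pi_apply i)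
    exact measurableSet_lt measurable_const ((this.const_mul _).const_sub _)
  have hlog : 0 ≤ Real.log (1 / δ) := Real.log_nonneg (by rw [le_div_iff₀ h0]; linarith)
  have hδ : Real.exp (-Real.log (1 / δ)) = δ := by
    rw [one_div, Real.log_inv, neg_neg, Real.exp_log h0]
  have hbad_le : ∀ k j, P (bad k j) ≤
      ENNReal.ofReal (δ * Real.exp (-((k + 1) * b)) * (1 / 2) ^ (k + 1)) := by
    intro k j
    rw [← ofReal_measureReal]
    refine ENNReal.ofReal_le_ofReal ((measureReal_hoeffding_le (hm k j) (by positivity) (hbd k j)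
      hn (by positivity)).trans ?_)
    -- The three terms supply the factor δ, the factor exp (-(k + 1) b) that pays for the
    -- cardinality of level k, and exp (-(k + 1)) ≤ 2^-(k + 1), which makes the levels sum to δ.
    have e : -(Real.log (1 / δ) + (k + 1) * (b + 1)) =
        -Real.log (1 / δ) + -((k + 1) * b) + (k + 1 : ℕ) * (-1) := by push_cast; ring
    rw [e, Real.exp_add, Real.exp_add, hδ, Real.exp_nat_mul]
    have : Real.exp (-1) ≤ 1 / 2 := by
      rw [Real.exp_neg, one_div]
      exact inv_anti₀ two_pos (by linarith [Real.add_one_le_exp 1])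
    gcongr
  have hlevel : ∀ k, P (⋃ j, bad k j) ≤ ENNReal.ofReal (δ * (1 / 2) ^ (k + 1)) := by
    intro k
    calc P (⋃ j, bad k j) ≤ ∑ j, P (bad k j) := measure_iUnion_fintype_le _ _
      _ ≤ ∑ _j : J k, ENNReal.ofReal (δ * Real.exp (-((k + 1) * b)) * (1 / 2) ^ (k + 1)) :=
          Finset.sum_le_sum fun j _ => hbad_le k j
      _ = ENNReal.ofReal (Fintype.card (J k) *
            (δ * Real.exp (-((k + 1) * b)) * (1 / 2) ^ (k + 1))) := by
          rw [Finset.sum_const, Finset.card_univ, nsmul_eq_mul,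
            ENNReal.ofReal_mul (Nat.cast_nonneg _), ENNReal.ofReal_natCast]
      _ ≤ ENNReal.ofReal (δ * (1 / 2) ^ (k + 1)) := by
          refine ENNReal.ofReal_le_ofReal ?_
          calc (Fintype.card (J k) : ℝ) * (δ * Real.exp (-((k + 1) * b)) * (1 / 2) ^ (k + 1))
              ≤ Real.exp ((k + 1) * b) * (δ * Real.exp (-((k + 1) * b)) * (1 / 2) ^ (k + 1)) := by
                gcongr; exact hJ k
            _ = (Real.exp ((k + 1) * b) * Real.exp (-((k + 1) * b))) * (δ * (1 / 2) ^ (k + 1)) := by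
                ring
            _ = δ * (1 / 2) ^ (k + 1) := by rw [← Real.exp_add]; simp
  have hsum : HasSum (fun k : ℕ => δ * (1 / 2 : ℝ) ^ (k + 1)) δ := by
    have h2 := hasSum_geometric_two.mul_left (δ / 2)
    rw [div_mul_cancel₀ δ two_ne_zero] at h2
    refine h2.congr_fun fun k => ?_
    ring
  have hU : P (⋃ k, ⋃ j, bad k j) ≤ ENNReal.ofReal δ := by
    calc P (⋃ k, ⋃ j, bad k j) ≤ ∑' k, P (⋃ j, bad k j) := measure_iUnion_le _
      _ ≤ ∑' k : ℕ, ENNReal.ofReal (δ * (1 / 2) ^ (k + 1)) := ENNReal.tsum_le_tsum hlevel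
      _ = ENNReal.ofReal δ := by
          rw [← ENNReal.ofReal_tsum_of_nonneg (fun k => by positivity) hsum.summable,
            hsum.tsum_eq]
  have hUm : MeasurableSet (⋃ k, ⋃ j, bad k j) :=
    .iUnion fun k => .iUnion fun j => hmeas k j
  refine ⟨(⋃ k, ⋃ j, bad k j)ᶜ, hUm.compl, ?_, ?_⟩
  · rw [prob_compl_eq_one_sub hUm, ENNReal.ofReal_sub _ h0.le, ENNReal.ofReal_one]
    exact tsub_le_tsub_left hU 1
  · intro X hX k j
    simp only [Set.mem_compl_iff, Set.mem_iUnion, not_exists] at hX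
    exact not_lt.1 (hX k j)

/-- Isolates the dependence on the level as a factor k + 1, which is summable against the geometric
ranges. -/
theorem sqrt_level_le {l B N : ℝ} (hl : 0 ≤ l) (hB : 1 ≤ B) (k : ℕ) :
    √(2 * (l + (k + 1) * B) / N) ≤ 2 * √B * (1 + √l) / √N * (k + 1) := by
  rw [Real.sqrt_div (by positivity), div_mul_eq_mul_div]
  refine div_le_div_of_nonneg_right ?_ (Real.sqrt_nonneg _)
  refine Real.sqrt_le_iff.2 ⟨by positivity, ?_⟩
  have e : (2 * √B * (1 + √l) * (k + 1)) ^ 2 =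
      4 * B * (1 + 2 * √l + l) * ((k : ℝ) + 1) ^ 2 := by
    have h1 := Real.sq_sqrt hl
    have h2 := Real.sq_sqrt (zero_le_one.trans hB)
    calc (2 * √B * (1 + √l) * (k + 1)) ^ 2
        = 4 * √B ^ 2 * (1 + 2 * √l + √l ^ 2) * ((k : ℝ) + 1) ^ 2 := by ring
      _ = _ := by rw [h1, h2]
  have hk : (1 : ℝ) ≤ k + 1 := by linarith [(Nat.cast_nonneg k : (0 : ℝ) ≤ k)]
  rw [e]
  calc 2 * (l + (k + 1) * B) ≤ 2 * (B * l * (k + 1) ^ 2 + B * (k + 1) ^ 2) := by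
        have hBk : (1 : ℝ) ≤ B * (k + 1) ^ 2 := one_le_mul_of_one_le_of_one_le hB (one_le_pow₀ hk)
        have h1 : l ≤ B * l * (k + 1) ^ 2 := by nlinarith
        have h2 : ((k : ℝ) + 1) * B ≤ B * (k + 1) ^ 2 := by
          nlinarith [mul_nonneg (zero_le_one.trans hB) (mul_nonneg (zero_le_one.trans hk)
            (sub_nonneg.2 hk))]
        linarith
    _ ≤ 4 * B * (1 + 2 * √l + l) * ((k : ℝ) + 1) ^ 2 := by
        have h1 : 0 ≤ B * ((k : ℝ) + 1) ^ 2 := by positivity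
        nlinarith [mul_nonneg h1 hl, mul_nonneg h1 (Real.sqrt_nonneg l)]

theorem sum_succ_mul_half_pow (m : ℕ) :
    ∑ k ∈ Finset.range m, ((k : ℝ) + 1) * (1 / 2) ^ k = 4 - (2 * m + 4) * (1 / 2) ^ m := by
  induction m with
  | zero => norm_num
  | succ m ih =>
    rw [Finset.sum_range_succ, ih]
    push_cast
    ring

variable {ι : Type*}

/-- The point of the dyadic grid of the unit cube at level `k` with the given numerators. -/
def dyadicPoint (k : ℕ) (z : ι → Fin (2 ^ k + 1)) : ι → ℝ := fun i => (z i : ℝ) / 2 ^ k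

/-- Numerators of the level `k` dyadic approximation from below. -/
def dyadicFloor (k : ℕ) (θ : ι → ℝ) : ι → Fin (2 ^ k + 1) :=
  fun i => ⟨min ⌊2 ^ k * θ i⌋₊ (2 ^ k), Nat.lt_succ_of_le (min_le_right _ _)⟩

theorem dyadicPoint_mem (k : ℕ) (z : ι → Fin (2 ^ k + 1)) : dyadicPoint k z ∈ Set.Icc 0 1 := by
  refine ⟨fun i => by simp only [dyadicPoint, Pi.zero_apply]; positivity, fun i => ?_⟩
  simp only [dyadicPoint, Pi.one_apply]
  rw [div_le_one (by positivity)]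
  exact_mod_cast Nat.lt_succ_iff.1 (z i).2

variable [Fintype ι]

theorem norm_sub_dyadicPoint_le (k : ℕ) {θ : ι → ℝ} (hθ : θ ∈ Set.Icc 0 1) :
    ‖θ - dyadicPoint k (dyadicFloor k θ)‖ ≤ (1 / 2) ^ k := by
  refine (pi_norm_le_iff_of_nonneg (by positivity)).2 fun i => ?_
  have h0 : 0 ≤ θ i := hθ.1 i
  have h1 : θ i ≤ 1 := hθ.2 i
  have hpow : (0 : ℝ) < 2 ^ k := by positivity
  have hle : 2 ^ k * θ i ≤ ((2 ^ k : ℕ) : ℝ) := by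
    push_cast
    exact mul_le_of_le_one_right hpow.le h1
  -- On the unit cube the cap in `dyadicFloor` is inactive.
  have hfl : ⌊2 ^ k * θ i⌋₊ ≤ 2 ^ k := Nat.floor_le_of_le hle
  have hf0 := Nat.floor_le (mul_nonneg hpow.le h0)
  have hf1 := Nat.lt_floor_add_one (2 ^ k * θ i)
  have e : (θ - dyadicPoint k (dyadicFloor k θ)) i =
      (2 ^ k * θ i - ⌊2 ^ k * θ i⌋₊) * (1 / 2) ^ k := by
    simp only [Pi.sub_apply, dyadicPoint, dyadicFloor, min_eq_left hfl, one_div, inv_pow]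
    field_simp
  rw [e, Real.norm_of_nonneg (mul_nonneg (by linarith) (by positivity))]
  exact mul_le_of_le_one_left (by positivity) (by linarith)

/-- Constant of the uniform deviation bound for a class of functions bounded by `A` that is
parametrized `K`-Lipschitz by a cube of dimension `p`. -/
def chainConst (p : ℕ) (A K : ℝ) : ℝ := 8 * (A + 3 * K) * √(2 * p + 1)

open Classical in
/-- Uniform deviation bound by chaining along dyadic grids of the parameter cube. -/
theorem exists_event_uniform_deviation {A K : ℝ} (hA0 : 0 ≤ A) (hK0 : 0 ≤ K)
    {f : (ι → ℝ) → Ω → ℝ} (hm : ∀ θ, Measurable (f θ))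
    (hA : ∀ θ ∈ Set.Icc (0 : ι → ℝ) 1, ∀ x, |f θ x| ≤ A)
    (hK : ∀ θ ∈ Set.Icc (0 : ι → ℝ) 1, ∀ θ' ∈ Set.Icc (0 : ι → ℝ) 1, ∀ x,
      |f θ x - f θ' x| ≤ K * ‖θ - θ'‖)
    {n : ℕ} (hn : 0 < n) {δ : ℝ} (h0 : 0 < δ) (h1 : δ < 1) :
    ∃ G : Set (Fin n → Ω), MeasurableSet G ∧
      ENNReal.ofReal (1 - δ) ≤ Measure.pi (fun _ : Fin n => μ) G ∧
      ∀ X ∈ G, ∀ θ ∈ Set.Icc (0 : ι → ℝ) 1,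
        ∫ x, f θ x ∂μ - 1 / (n : ℝ) * ∑ i, f θ (X i) ≤
          chainConst (Fintype.card ι) A K * (1 + √(Real.log (1 / δ))) / √(n : ℝ) := by
  have hn' : (0 : ℝ) < n := by exact_mod_cast hn
  have hint : ∀ θ ∈ Set.Icc (0 : ι → ℝ) 1, Integrable (f θ) μ := fun θ hθ =>
    Integrable.of_bound (hm θ).aestronglyMeasurable A (.of_forall fun x => hA θ hθ x)
  -- A bounds the root of the chain. A link between levels k and k + 1 is at most K (2^-(k+1) +
  -- 2^-k) = 3K 2^-(k+1).
  set c := A + 3 * K with hc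
  -- Links are pairs of grid points on consecutive levels. At k = 0 the first component, where k - 1
  -- truncates to 0, is ignored.
  let J : ℕ → Type _ := fun k => (ι → Fin (2 ^ (k - 1) + 1)) × (ι → Fin (2 ^ k + 1))
  let D : ∀ k, J k → Ω → ℝ := fun k j x =>
    f (dyadicPoint k j.2) x - if k = 0 then 0 else f (dyadicPoint (k - 1) j.1) x
  have hDm : ∀ k j, Measurable (D k j) := by
    intro k j
    refine (hm _).sub ?_
    by_cases hk : k = 0
    · simp [hk]
    · simpa [hk] using hm _
  let h : ∀ k, J k → Ω → ℝ := fun k j =>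
    if ∀ x, |D k j x| ≤ c * (1 / 2) ^ k then D k j else 0
  have hJ : ∀ k, (Fintype.card (J k) : ℝ) ≤ Real.exp ((k + 1) * (2 * Fintype.card ι : ℝ)) := by
    intro k
    -- Each grid has at most exp (k + 1) values per coordinate, and a link uses two grids, hence b =
    -- 2 · card ι.
    have hp : ∀ m ≤ k, (((2 ^ m + 1 : ℕ) : ℝ)) ≤ Real.exp (k + 1) := by
      intro m hmk
      have h2 : (2 : ℝ) ≤ Real.exp 1 := by linarith [Real.add_one_le_exp 1]
      calc (((2 ^ m + 1 : ℕ) : ℝ)) ≤ 2 ^ k + 2 ^ k := by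
            push_cast
            exact add_le_add (pow_le_pow_right₀ one_le_two hmk) (one_le_pow₀ one_le_two)
        _ = 2 ^ (k + 1) := by ring
        _ ≤ Real.exp 1 ^ (k + 1) := by gcongr
        _ = Real.exp (k + 1) := by rw [← Real.exp_nat_mul]; push_cast; ring_nf
    have hcard : (Fintype.card (J k) : ℝ) =
        ((2 ^ (k - 1) + 1 : ℕ) : ℝ) ^ Fintype.card ι * ((2 ^ k + 1 : ℕ) : ℝ) ^ Fintype.card ι := by
      simp [J]
    rw [hcard]
    calc _ ≤ Real.exp (k + 1) ^ Fintype.card ι * Real.exp (k + 1) ^ Fintype.card ι :=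
          mul_le_mul (pow_le_pow_left₀ (Nat.cast_nonneg _) (hp _ (Nat.sub_le k 1)) _)
            (pow_le_pow_left₀ (Nat.cast_nonneg _) (hp k le_rfl) _) (by positivity) (by positivity)
      _ = Real.exp ((k + 1) * (2 * Fintype.card ι : ℝ)) := by
          rw [← Real.exp_nat_mul, ← Real.exp_add]; ring_nf
  have hhm : ∀ k j, Measurable (h k j) := by
    intro k j
    by_cases hj : ∀ x, |D k j x| ≤ c * (1 / 2) ^ k
    · simpa only [h, if_pos hj] using hDm k j
    · simpa only [h, if_neg hj] using measurable_zero
  have hc0 : 0 ≤ c := by positivity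
  have hhb : ∀ k j x, |h k j x| ≤ c * (1 / 2) ^ k := by
    intro k j x
    by_cases hj : ∀ x, |D k j x| ≤ c * (1 / 2) ^ k
    · simpa only [h, if_pos hj] using hj x
    · simp only [h, if_neg hj, Pi.zero_apply, abs_zero]
      positivity
  obtain ⟨G, hGm, hGp, hG⟩ := exists_event_forall_level (μ := μ) (b := 2 * Fintype.card ι)
    (by positivity) hc0 hJ hhm hhb hn h0 h1
  refine ⟨G, hGm, hGp, fun X hX θ hθ => ?_⟩
  set l := Real.log (1 / δ) with hl
  have hl0 : 0 ≤ l := Real.log_nonneg (by rw [le_div_iff₀ h0]; linarith)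
  let π : ℕ → ι → ℝ := fun k => dyadicPoint k (dyadicFloor k θ)
  let j : ∀ k, J k := fun k => (dyadicFloor (k - 1) θ, dyadicFloor k θ)
  have hπ : ∀ k, π k ∈ Set.Icc (0 : ι → ℝ) 1 := fun k => dyadicPoint_mem _ _
  have hπd : ∀ k, ‖θ - π k‖ ≤ (1 / 2) ^ k := fun k => norm_sub_dyadicPoint_le k hθ
  have hDj : ∀ k x, |D k (j k) x| ≤ c * (1 / 2) ^ k := by
    intro k x
    rcases k with _ | k
    · have := hA _ (hπ 0) x
      simp only [D, j, if_true, sub_zero, pow_zero, mul_one]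
      exact this.trans (by linarith)
    · have h2 := hK _ (hπ (k + 1)) _ (hπ k) x
      have h3 : ‖π (k + 1) - π k‖ ≤ (1 / 2) ^ (k + 1) + (1 / 2) ^ k := by
        have e : π (k + 1) - π k = (θ - π k) - (θ - π (k + 1)) := by abel
        rw [e]
        exact (norm_sub_le _ _).trans (by linarith [hπd k, hπd (k + 1)])
      have e : D (k + 1) (j (k + 1)) x = f (π (k + 1)) x - f (π k) x := by
        simp [D, j, π]
      rw [e]
      calc _ ≤ K * ((1 / 2) ^ (k + 1) + (1 / 2) ^ k) := h2.trans (by gcongr)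
        _ = 3 * K * (1 / 2) ^ (k + 1) := by ring
        _ ≤ c * (1 / 2) ^ (k + 1) := by gcongr; linarith
  have hhj : ∀ k, h k (j k) = D k (j k) := fun k => if_pos (hDj k)
  let dev : (Ω → ℝ) → ℝ := fun g => ∫ x, g x ∂μ - 1 / (n : ℝ) * ∑ i, g (X i)
  have dev_sub : ∀ {g g' : Ω → ℝ}, Integrable g μ → Integrable g' μ →
      dev (fun x => g x - g' x) = dev g - dev g' := by
    intro g g' hg hg'
    simp only [dev, integral_sub hg hg', Finset.sum_sub_distrib]
    ring
  have htel : ∀ m, dev (f (π m)) = ∑ k ∈ Finset.range (m + 1), dev (h k (j k)) := by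
    intro m
    induction m with
    | zero => simp [hhj, D, j, π]
    | succ m ih =>
      rw [Finset.sum_range_succ, ← ih, hhj]
      have e : D (m + 1) (j (m + 1)) = fun x => f (π (m + 1)) x - f (π m) x := by
        funext x; simp [D, j, π]
      rw [e, dev_sub (hint _ (hπ _)) (hint _ (hπ _))]
      ring
  set R := 2 * √(2 * Fintype.card ι + 1) * (1 + √l) / √(n : ℝ) with hR
  have hR0 : 0 ≤ R := by positivity
  have hchain : ∀ m, dev (f (π m)) ≤ 4 * c * R := by
    intro m
    calc dev (f (π m)) = ∑ k ∈ Finset.range (m + 1), dev (h k (j k)) := htel m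
      _ ≤ ∑ k ∈ Finset.range (m + 1), c * R * (((k : ℝ) + 1) * (1 / 2) ^ k) := by
          refine Finset.sum_le_sum fun k _ => (hG X hX k (j k)).trans ?_
          calc _ ≤ c * (1 / 2) ^ k * (R * (k + 1)) :=
                mul_le_mul_of_nonneg_left (sqrt_level_le hl0 (by linarith [(Nat.cast_nonneg
                  (Fintype.card ι) : (0 : ℝ) ≤ Fintype.card ι)]) k) (by positivity)
            _ = _ := by ring
      _ = c * R * (4 - (2 * (m + 1 : ℕ) + 4) * (1 / 2) ^ (m + 1)) := by
          rw [← Finset.mul_sum, sum_succ_mul_half_pow]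
      _ ≤ c * R * 4 := by
          refine mul_le_mul_of_nonneg_left (sub_le_self _ (by positivity)) (by positivity)
      _ = 4 * c * R := by ring
  -- Both the mean and the sample average move by at most K 2^-m when θ is replaced by its grid
  -- point; letting m tend to infinity removes this error.
  have hfar : ∀ m, dev (f θ) ≤ 4 * c * R + 2 * K * (1 / 2) ^ m := by
    intro m
    have hd : ∀ x, |f θ x - f (π m) x| ≤ K * (1 / 2) ^ m := fun x =>
      (hK θ hθ _ (hπ m) x).trans (by gcongr; exact hπd m)
    have e : dev (f θ) = dev (f (π m)) + dev (fun x => f θ x - f (π m) x) := by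
      rw [dev_sub (hint _ hθ) (hint _ (hπ m))]; ring
    have h2 : ∫ x, (f θ x - f (π m) x) ∂μ ≤ K * (1 / 2) ^ m := by
      have := integral_mono ((hint _ hθ).sub (hint _ (hπ m)))
        (integrable_const (K * (1 / 2) ^ m)) (fun x => (le_abs_self _).trans (hd x))
      simpa using this
    have h3 : -(K * (1 / 2) ^ m) ≤ 1 / (n : ℝ) * ∑ i, (f θ (X i) - f (π m) (X i)) := by
      have h4 : ∑ _i : Fin n, -(K * (1 / 2) ^ m) ≤ ∑ i, (f θ (X i) - f (π m) (X i)) :=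
        Finset.sum_le_sum fun i _ => (abs_le.1 (hd (X i))).1
      have h5 := mul_le_mul_of_nonneg_left h4 (by positivity : 0 ≤ 1 / (n : ℝ))
      refine le_trans (le_of_eq ?_) h5
      simp only [Finset.sum_const, Finset.card_univ, Fintype.card_fin, nsmul_eq_mul]
      field_simp
    have h6 : dev (fun x => f θ x - f (π m) x) ≤ 2 * K * (1 / 2) ^ m := by
      simp only [dev]; linarith
    linarith [hchain m]
  have hlim : Filter.Tendsto (fun m : ℕ => 4 * c * R + 2 * K * (1 / 2 : ℝ) ^ m) Filter.atTop
      (nhds (4 * c * R + 2 * K * 0)) :=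
    ((tendsto_pow_atTop_nhds_zero_of_lt_one (by norm_num) (by norm_num)).const_mul _).const_add _
  have := ge_of_tendsto' hlim hfar
  refine this.trans (le_of_eq ?_)
  -- The 8 is 4, from the sum of (k + 1) 2^-k, times the 2 of `sqrt_level_le`.
  rw [chainConst, ← hc, hR]
  ring

end Chaining

/-! ### Learned layers and the uniform deviation of their distances -/

section Quality

variable {ds dt : ℕ} {s ω Cx Cy : ℝ}

theorem frob_mono {L N : Matrix (Fin dt) (Fin ds) ℝ} (h : ∀ p q, |L p q| ≤ N p q) :
    frob L ≤ frob N :=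
  Real.sqrt_le_sqrt <| Finset.sum_le_sum fun p _ => Finset.sum_le_sum fun q _ => by
    rw [← sq_abs]
    exact pow_le_pow_left₀ (abs_nonneg _) (h p q) 2

theorem mul_tanh_lt (hs : 0 < s) (a : ℝ) : s * Real.tanh a < s :=
  mul_lt_of_lt_one_right hs (Real.tanh_lt_one a)

/-- Radius of a ball that contains the gyrobarycenters and the image of the source ball under
the layers of Frobenius norm at most `F`. -/
def imageRadius (s Cx Cy F : ℝ) : ℝ :=
  max (max (baryRadius s Cy) Cy) (s * Real.tanh (F * Real.artanh (Cx / s)))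

theorem imageRadius_nonneg {F : ℝ} (h0 : 0 ≤ Cy) : 0 ≤ imageRadius s Cx Cy F :=
  h0.trans ((le_max_right _ _).trans (le_max_left _ _))

theorem imageRadius_lt {F : ℝ} (hs : 0 < s) (hCy : Cy < s) : imageRadius s Cx Cy F < s :=
  max_lt (max_lt (baryRadius_lt hs hCy) hCy) (mul_tanh_lt hs _)

/-- Bound for the Poincaré distance between two points of the ball of radius `ρ`. -/
def pdistMax (s ρ : ℝ) : ℝ := pdistLip s ρ * (2 * ρ)

/-- Bound for the entries of `L - K` when `L` is learned with regularizer `ω ‖L - K‖²`. -/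
def learnedRadius (s ω Cx Cy : ℝ) (K : Matrix (Fin dt) (Fin ds) ℝ) : ℝ :=
  √(pdistMax s (imageRadius s Cx Cy (frob K)) / ω) + 1

/-- The summand 1 in the radius ensures this, so that `exists_cubeMatrix_eq` can divide by it. -/
theorem learnedRadius_pos (K : Matrix (Fin dt) (Fin ds) ℝ) : 0 < learnedRadius s ω Cx Cy K := by
  unfold learnedRadius; positivity

/-- Compare with `K` itself: its regularizer vanishes and its fitting term is at most the diameter
bound `pdistMax`, while the fitting term of `L` is nonnegative. Hence ω ‖L - K‖² is at most that
bound, and so is ω times each squared entry. -/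
theorem IsLearned.abs_sub_le {n m : ℕ} {K L : Matrix (Fin dt) (Fin ds) ℝ} {X : Fin n → E ds}
    {Xt : Fin m → E dt} {M : Matrix (Fin n) (Fin m) ℝ} (h : IsLearned s ω K X Xt M L)
    (hs : 0 < s) (hω : 0 < ω) (hCx : Cx < s) (hy0 : 0 ≤ Cy) (hCy : Cy < s) (hn : 0 < n)
    (hX : ∀ i, ‖X i‖ ≤ Cx) (hXt : ∀ j, ‖Xt j‖ ≤ Cy) (hM : ∀ i j, 0 ≤ M i j) (p : Fin dt)
    (q : Fin ds) : |L p q - K p q| ≤ learnedRadius s ω Cx Cy K := by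
  have hn' : (0 : ℝ) < n := by exact_mod_cast hn
  set ρ := imageRadius s Cx Cy (frob K) with hρ
  have hloss := h K
  have hfit0 : 0 ≤ 1 / (n : ℝ) * ∑ i, pdist s (gyroBary s M Xt i) (mobLayer s L (X i)) :=
    mul_nonneg (by positivity) (Finset.sum_nonneg fun i _ => pdist_nonneg hs.le _ _)
  have hfit : 1 / (n : ℝ) * ∑ i, pdist s (gyroBary s M Xt i) (mobLayer s K (X i)) ≤
      pdistMax s ρ := by
    have h1 : ∑ i, pdist s (gyroBary s M Xt i) (mobLayer s K (X i)) ≤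
        ∑ _i : Fin n, pdistMax s ρ :=
      Finset.sum_le_sum fun i _ => pdist_le_const hs (imageRadius_nonneg hy0)
        (imageRadius_lt hs hCy)
        ((norm_gyroBary_le hs hy0 hCy hM hXt i).trans
          ((le_max_left _ _).trans (le_max_left _ _)))
        ((norm_mobLayer_le hs hCx le_rfl (hX i)).trans (le_max_right _ _))
    rw [Finset.sum_const, Finset.card_univ, Fintype.card_fin, nsmul_eq_mul] at h1
    rw [one_div_mul_eq_div, div_le_iff₀ hn', mul_comm (pdistMax s ρ)]
    exact h1
  have hreg : (L p q - K p q) ^ 2 ≤ ∑ p, ∑ q, (L p q - K p q) ^ 2 :=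
    (Finset.single_le_sum (f := fun q => (L p q - K p q) ^ 2) (fun q _ => sq_nonneg _)
      (Finset.mem_univ q)).trans
      (Finset.single_le_sum (f := fun p => ∑ q, (L p q - K p q) ^ 2)
        (fun p _ => Finset.sum_nonneg fun q _ => sq_nonneg _) (Finset.mem_univ p))
  simp only [qualityLoss, sub_self, ne_eq, OfNat.ofNat_ne_zero, not_false_eq_true, zero_pow,
    Finset.sum_const_zero, mul_zero, add_zero] at hloss
  have hsq : (L p q - K p q) ^ 2 ≤ pdistMax s ρ / ω := by
    rw [le_div_iff₀ hω, mul_comm]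
    exact (mul_le_mul_of_nonneg_left hreg hω.le).trans (by linarith)
  exact (Real.abs_le_sqrt hsq).trans (by rw [learnedRadius]; linarith)

/-- The matrices with entries at distance at most `r` from those of `K`, parametrized by the unit
cube. -/
def cubeMatrix (K : Matrix (Fin dt) (Fin ds) ℝ) (r : ℝ) (θ : Fin dt × Fin ds → ℝ) :
    Matrix (Fin dt) (Fin ds) ℝ := fun p q => K p q + r * (2 * θ (p, q) - 1)

theorem exists_cubeMatrix_eq {K L : Matrix (Fin dt) (Fin ds) ℝ} {r : ℝ} (hr : 0 < r)
    (h : ∀ p q, |L p q - K p q| ≤ r) :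
    ∃ θ ∈ Set.Icc (0 : Fin dt × Fin ds → ℝ) 1, cubeMatrix K r θ = L := by
  refine ⟨fun i => ((L i.1 i.2 - K i.1 i.2) / r + 1) / 2, ⟨fun i => ?_, fun i => ?_⟩, ?_⟩
  · have := (le_div_iff₀ hr).2 (by linarith [(abs_le.1 (h i.1 i.2)).1] :
      -1 * r ≤ L i.1 i.2 - K i.1 i.2)
    simp only [Pi.zero_apply]
    linarith
  · have := (div_le_iff₀ hr).2 (by linarith [(abs_le.1 (h i.1 i.2)).2] :
      L i.1 i.2 - K i.1 i.2 ≤ 1 * r)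
    simp only [Pi.one_apply]
    linarith
  · ext p q
    simp only [cubeMatrix]
    field_simp
    ring

theorem frob_cubeMatrix_le {K : Matrix (Fin dt) (Fin ds) ℝ} {r : ℝ} (hr : 0 ≤ r)
    {θ : Fin dt × Fin ds → ℝ} (hθ : θ ∈ Set.Icc (0 : Fin dt × Fin ds → ℝ) 1) :
    frob (cubeMatrix K r θ) ≤ frob (fun p q => |K p q| + r) := by
  refine frob_mono fun p q => (abs_add_le _ _).trans (add_le_add_right ?_ _)
  have h0 : 0 ≤ θ (p, q) := hθ.1 _
  have h1 : θ (p, q) ≤ 1 := hθ.2 _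
  rw [abs_mul, abs_of_nonneg hr]
  exact mul_le_of_le_one_right hr (abs_le.2 ⟨by linarith, by linarith⟩)

theorem frob_cubeMatrix_sub_le (K : Matrix (Fin dt) (Fin ds) ℝ) {r : ℝ} (hr : 0 ≤ r)
    (θ θ' : Fin dt × Fin ds → ℝ) :
    frob (cubeMatrix K r θ - cubeMatrix K r θ') ≤ √((dt : ℝ) * ds) * (2 * r * ‖θ - θ'‖) := by
  refine frob_le_of_forall_abs_le (by positivity) fun p q => ?_
  have e : (cubeMatrix K r θ - cubeMatrix K r θ') p q = 2 * r * (θ - θ') (p, q) := by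
    simp only [cubeMatrix, Matrix.sub_apply, Pi.sub_apply]
    ring
  rw [e, abs_mul, abs_of_nonneg (by positivity)]
  exact mul_le_mul_of_nonneg_left (norm_le_pi_norm (θ - θ') (p, q)) (by positivity)

/-- Lipschitz constant of `θ ↦ pdist s (mobLayer s (cubeMatrix K r θ) x) y`. -/
def layerLip (dt ds : ℕ) (s ρ Cx r : ℝ) : ℝ :=
  pdistLip s ρ * (3 * s * (√((dt : ℝ) * ds) * (2 * r) * Real.artanh (Cx / s)))

theorem abs_pdist_sub_pdist_le {d : ℕ} (hs : 0 < s) {x y z : E d} (hx : ‖x‖ < s) (hy : ‖y‖ < s)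
    (hz : ‖z‖ < s) : |pdist s x z - pdist s y z| ≤ pdist s x y := by
  have h1 := pdist_triangle hs hx hy hz
  have h2 := pdist_triangle hs hy hx hz
  rw [pdist_comm hs hy hx] at h2
  exact abs_le.2 ⟨by linarith, by linarith⟩

/-- Chaining applied to the matrix cube. The norm bounds on x and `B x` hold only almost everywhere,
whereas chaining needs pointwise ones, so the functions are cut off outside the full-measure set S
where both hold. -/
theorem exists_event_layer_deviation (hs : 0 < s) (hx0 : 0 ≤ Cx) (hCx : Cx < s) (hy0 : 0 ≤ Cy)
    (hCy : Cy < s) (K : Matrix (Fin dt) (Fin ds) ℝ) {r : ℝ} (hr : 0 ≤ r)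
    {μ : Measure (E ds)} [IsProbabilityMeasure μ] (hμ : ∀ᵐ x ∂μ, ‖x‖ ≤ Cx) {B : E ds → E dt}
    (hB : Measurable B) (hBμ : ∀ᵐ x ∂μ, ‖B x‖ ≤ baryRadius s Cy) {n : ℕ} (hn : 0 < n) {δ : ℝ}
    (h0 : 0 < δ) (h1 : δ < 1) {ρ : ℝ}
    (hρ : ρ = imageRadius s Cx Cy (frob fun p q => |K p q| + r)) :
    ∃ G : Set (Fin n → E ds), MeasurableSet G ∧
      ENNReal.ofReal (1 - δ) ≤ Measure.pi (fun _ : Fin n => μ) G ∧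
      ∀ X ∈ G, (∀ i, ‖X i‖ ≤ Cx ∧ ‖B (X i)‖ ≤ baryRadius s Cy) ∧
        ∀ θ ∈ Set.Icc (0 : Fin dt × Fin ds → ℝ) 1,
          ∫ x, pdist s (mobLayer s (cubeMatrix K r θ) x) (B x) ∂μ -
            1 / (n : ℝ) * ∑ i, pdist s (mobLayer s (cubeMatrix K r θ) (X i)) (B (X i)) ≤
          chainConst (Fintype.card (Fin dt × Fin ds)) (pdistMax s ρ) (layerLip dt ds s ρ Cx r) *
            (1 + √(Real.log (1 / δ))) / √(n : ℝ) := by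
  have hρ0 : 0 ≤ ρ := hρ ▸ imageRadius_nonneg hy0
  have hρs : ρ < s := hρ ▸ imageRadius_lt hs hCy
  have hlip := pdistLip_pos hs hρ0 hρs
  have hw : 0 ≤ Real.artanh (Cx / s) := Real.artanh_nonneg (by positivity)
  set S : Set (E ds) := {x | ‖x‖ ≤ Cx ∧ ‖B x‖ ≤ baryRadius s Cy} with hS
  have hSm : MeasurableSet S :=
    (measurableSet_le measurable_norm measurable_const).inter
      (measurableSet_le hB.norm measurable_const)
  have hSμ : ∀ᵐ x ∂μ, x ∈ S := by
    filter_upwards [hμ, hBμ] with x h h' using ⟨h, h'⟩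
  have hBρ : ∀ x ∈ S, ‖B x‖ ≤ ρ := fun x hx =>
    hx.2.trans (hρ ▸ (le_max_left _ _).trans (le_max_left _ _))
  have hTρ : ∀ θ ∈ Set.Icc (0 : Fin dt × Fin ds → ℝ) 1, ∀ x ∈ S,
      ‖mobLayer s (cubeMatrix K r θ) x‖ ≤ ρ := fun θ hθ x hx =>
    (norm_mobLayer_le hs hCx (frob_cubeMatrix_le hr hθ) hx.1).trans (hρ ▸ le_max_right _ _)
  have hlip0 : 0 ≤ layerLip dt ds s ρ Cx r := by unfold layerLip; positivity
  have hmax0 : 0 ≤ pdistMax s ρ := by unfold pdistMax; positivity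
  let f : (Fin dt × Fin ds → ℝ) → E ds → ℝ := fun θ =>
    S.indicator fun x => pdist s (mobLayer s (cubeMatrix K r θ) x) (B x)
  have hfm : ∀ θ, Measurable (f θ) := fun θ =>
    ((measurable_pdist s).comp ((measurable_mobLayer s _).prodMk hB)).indicator hSm
  have hfA : ∀ θ ∈ Set.Icc (0 : Fin dt × Fin ds → ℝ) 1, ∀ x, |f θ x| ≤ pdistMax s ρ := by
    intro θ hθ x
    simp only [f]
    by_cases hx : x ∈ S
    · rw [Set.indicator_of_mem hx, abs_of_nonneg (pdist_nonneg hs.le _ _)]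
      exact pdist_le_const hs hρ0 hρs (hTρ θ hθ x hx) (hBρ x hx)
    · rwa [Set.indicator_of_notMem hx, abs_zero]
  have hfK : ∀ θ ∈ Set.Icc (0 : Fin dt × Fin ds → ℝ) 1,
      ∀ θ' ∈ Set.Icc (0 : Fin dt × Fin ds → ℝ) 1, ∀ x,
      |f θ x - f θ' x| ≤ layerLip dt ds s ρ Cx r * ‖θ - θ'‖ := by
    intro θ hθ θ' hθ' x
    simp only [f]
    by_cases hx : x ∈ S
    · rw [Set.indicator_of_mem hx, Set.indicator_of_mem hx]
      have hT := hTρ θ hθ x hx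
      have hT' := hTρ θ' hθ' x hx
      refine (abs_pdist_sub_pdist_le hs (hT.trans_lt hρs) (hT'.trans_lt hρs)
        ((hBρ x hx).trans_lt hρs)).trans ((pdist_le hs hρ0 hρs hT hT').trans ?_)
      rw [layerLip, mul_assoc]
      refine mul_le_mul_of_nonneg_left ((norm_mobLayer_sub_le hs hCx _ _ hx.1).trans ?_) hlip.le
      calc 3 * s * (frob (cubeMatrix K r θ - cubeMatrix K r θ') * Real.artanh (Cx / s))
          ≤ 3 * s * (√((dt : ℝ) * ds) * (2 * r * ‖θ - θ'‖) * Real.artanh (Cx / s)) := by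
            gcongr
            exact frob_cubeMatrix_sub_le K hr θ θ'
        _ = _ := by ring
    · rw [Set.indicator_of_notMem hx, Set.indicator_of_notMem hx, sub_zero, abs_zero]
      positivity
  obtain ⟨G, hGm, hGp, hG⟩ := exists_event_uniform_deviation (μ := μ) hmax0 hlip0 hfm hfA hfK
    hn h0 h1
  refine ⟨G ∩ {X | ∀ i, X i ∈ S}, hGm.inter ?_, hGp.trans ?_, ?_⟩
  · have e : {X : Fin n → E ds | ∀ i, X i ∈ S} = ⋂ i, (fun X => X i) ⁻¹' S := by ext; simp
    rw [e]
    exact .iInter fun i => measurable_pi_apply i hSm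
  -- Almost every sample lies in S, so requiring this costs no probability.
  · refine measure_mono_ae ?_
    have : ∀ᵐ X ∂Measure.pi fun _ : Fin n => μ, ∀ i, X i ∈ S :=
      ae_all_iff.2 fun i =>
        (Measure.quasiMeasurePreserving_eval (fun _ : Fin n => μ) i).ae hSμ
    filter_upwards [this] with X hX hXG using ⟨hXG, hX⟩
  · rintro X ⟨hXG, hXS⟩
    refine ⟨hXS, fun θ hθ => ?_⟩
    have h2 := hG X hXG θ hθ
    have e1 : ∫ x, S.indicator
        (fun x => pdist s (mobLayer s (cubeMatrix K r θ) x) (B x)) x ∂μ =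
        ∫ x, pdist s (mobLayer s (cubeMatrix K r θ) x) (B x) ∂μ := by
      refine integral_congr_ae ?_
      filter_upwards [hSμ] with x hx using Set.indicator_of_mem hx _
    have e2 : ∑ i, S.indicator
        (fun x => pdist s (mobLayer s (cubeMatrix K r θ) x) (B x)) (X i) =
        ∑ i, pdist s (mobLayer s (cubeMatrix K r θ) (X i)) (B (X i)) :=
      Finset.sum_congr rfl fun i _ => Set.indicator_of_mem (hXS i) _
    rwa [e1, e2] at h2

theorem integrable_pdist {μ : Measure (E ds)} [IsFiniteMeasure μ] {ρ : ℝ} (hs : 0 < s)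
    (h0 : 0 ≤ ρ) (hρ : ρ < s) {f g : E ds → E dt} (hf : Measurable f) (hg : Measurable g)
    (hfρ : ∀ᵐ x ∂μ, ‖f x‖ ≤ ρ) (hgρ : ∀ᵐ x ∂μ, ‖g x‖ ≤ ρ) :
    Integrable (fun x => pdist s (f x) (g x)) μ := by
  refine Integrable.of_bound ((measurable_pdist s).comp (hf.prodMk hg)).aestronglyMeasurable
    (pdistMax s ρ) ?_
  filter_upwards [hfρ, hgρ] with x h h'
  rw [Real.norm_of_nonneg (pdist_nonneg hs.le _ _)]
  exact pdist_le_const hs h0 hρ h h'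

/-- Constant of the quality bound. -/
def qualityConst (s ω Cx Cy : ℝ) (K : Matrix (Fin dt) (Fin ds) ℝ) : ℝ :=
  chainConst (Fintype.card (Fin dt × Fin ds))
    (pdistMax s (imageRadius s Cx Cy (frob fun p q => |K p q| + learnedRadius s ω Cx Cy K)))
    (layerLip dt ds s (imageRadius s Cx Cy (frob fun p q => |K p q| + learnedRadius s ω Cx Cy K))
      Cx (learnedRadius s ω Cx Cy K))

end Quality

end HypOT

end

/-! ### Assembly of the quality bound -/

theorem theorem2 (ds dt : ℕ) (s ω Cx Cy : ℝ) (K : Matrix (Fin dt) (Fin ds) ℝ)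
    (hs : 0 < s) (hω : 0 < ω) (hCx : Cx < s) (hCy : Cy < s) :
    ∃ C : ℝ, 0 < C ∧
      ∀ (μs : Measure (HypOT.E ds)) (μt : Measure (HypOT.E dt))
        (M₀ : Measure (HypOT.E ds × HypOT.E dt)) (Tstar : HypOT.E ds → HypOT.E dt)
        [IsProbabilityMeasure μs] [IsProbabilityMeasure μt] [IsProbabilityMeasure M₀],
        (∀ᵐ x ∂μs, ‖x‖ ≤ Cx) → (∀ᵐ y ∂μt, ‖y‖ ≤ Cy) →
        -- `M₀` is a coupling of `μs` and `μt`, and `Tstar` transports `μs` to `μt`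
        M₀.fst = μs → M₀.snd = μt → MeasurePreserving Tstar μs μt →
        ∀ (n : ℕ), 0 < n → ∀ (δ : ℝ), 0 < δ → δ < 1 →
          -- an event of probability at least `1 - δ` over `n` i.i.d. source samples
          ∃ G : Set (Fin n → HypOT.E ds), MeasurableSet G ∧
            ENNReal.ofReal (1 - δ) ≤ Measure.pi (fun _ : Fin n => μs) G ∧
            ∀ X ∈ G, ∀ (m : ℕ) (Xt : Fin m → HypOT.E dt), (∀ j, ‖Xt j‖ ≤ Cy) →
              ∀ (a : Fin n → ℝ) (b : Fin m → ℝ),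
                a ∈ stdSimplex ℝ (Fin n) → (∀ i, 0 < a i) → b ∈ stdSimplex ℝ (Fin m) →
              ∀ Mhat ∈ HypOT.couplings a b, ∀ L : Matrix (Fin dt) (Fin ds) ℝ,
                HypOT.IsLearned s ω K X Xt Mhat L →
                Integrable (fun x => HypOT.pdist s (HypOT.mobLayer s L x) (Tstar x)) μs ∧
                Integrable (fun x => HypOT.pdist s (Tstar x) (HypOT.gyroBaryPop s M₀ x)) μs ∧
                ∫ x, HypOT.pdist s (HypOT.mobLayer s L x) (Tstar x) ∂μs ≤
                  1 / (n : ℝ) * ∑ i, HypOT.pdist s (HypOT.mobLayer s L (X i))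
                      (HypOT.gyroBary s Mhat Xt i)
                  + 1 / (n : ℝ) * ∑ i, HypOT.pdist s (HypOT.gyroBary s Mhat Xt i)
                      (HypOT.gyroBaryPop s M₀ (X i))
                  + ∫ x, HypOT.pdist s (Tstar x) (HypOT.gyroBaryPop s M₀ x) ∂μs
                  + C * (1 + √(Real.log (1 / δ))) / √(n : ℝ) := by
  -- The radii may be negative as given; enlarging them to be nonnegative keeps them below s.
  have hx0 : 0 ≤ max Cx 0 := le_max_right _ _
  have hy0 : 0 ≤ max Cy 0 := le_max_right _ _
  have hxs : max Cx 0 < s := max_lt hCx hs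
  have hys : max Cy 0 < s := max_lt hCy hs
  have hx_le : Cx ≤ max Cx 0 := le_max_left _ _
  have hy_le : Cy ≤ max Cy 0 := le_max_left _ _
  generalize max Cx 0 = Cx' at *
  generalize max Cy 0 = Cy' at *
  -- `qualityConst` can be 0, for instance when both radii vanish, and the constant must be
  -- positive.
  refine ⟨max (HypOT.qualityConst s ω Cx' Cy' K) 1, lt_max_of_lt_right one_pos, ?_⟩
  intro μs μt M₀ Tstar _ _ _ hμs hμt hfst hsnd hT n hn δ h0 h1
  set r := HypOT.learnedRadius s ω Cx' Cy' K with hr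
  have hr0 : 0 < r := HypOT.learnedRadius_pos K
  set ρ := HypOT.imageRadius s Cx' Cy' (HypOT.frob fun p q => |K p q| + r) with hρ
  have hρ0 : 0 ≤ ρ := HypOT.imageRadius_nonneg hy0
  have hρs : ρ < s := HypOT.imageRadius_lt hs hys
  have hVρ : HypOT.baryRadius s Cy' ≤ ρ := (le_max_left _ _).trans (le_max_left _ _)
  have hCyρ : Cy' ≤ ρ := (le_max_right _ _).trans (le_max_left _ _)
  have hμs' : ∀ᵐ x ∂μs, ‖x‖ ≤ Cx' := hμs.mono fun x h => h.trans hx_le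
  have hμt' : ∀ᵐ y ∂μt, ‖y‖ ≤ Cy' := hμt.mono fun y h => h.trans hy_le
  have hB : Measurable (HypOT.gyroBaryPop s M₀) := HypOT.measurable_gyroBaryPop M₀
  have hBV : ∀ᵐ x ∂μs, ‖HypOT.gyroBaryPop s M₀ x‖ ≤ HypOT.baryRadius s Cy' :=
    hfst ▸ HypOT.ae_norm_gyroBaryPop_le hs hy0 hys (hsnd.symm ▸ hμt')
  have hTρ : ∀ᵐ x ∂μs, ‖Tstar x‖ ≤ ρ :=
    (hT.quasiMeasurePreserving.ae hμt').mono fun x h => h.trans hCyρ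
  have hBρ : ∀ᵐ x ∂μs, ‖HypOT.gyroBaryPop s M₀ x‖ ≤ ρ := hBV.mono fun x h => h.trans hVρ
  obtain ⟨G, hGm, hGp, hG⟩ := HypOT.exists_event_layer_deviation hs hx0 hxs hy0 hys K hr0.le
    hμs' hB hBV hn h0 h1 hρ
  refine ⟨G, hGm, hGp, fun X hX m Xt hXt a b _ _ _ Mhat hMhat L hL => ?_⟩
  obtain ⟨hXS, hdev⟩ := hG X hX
  have hXt' : ∀ j, ‖Xt j‖ ≤ Cy' := fun j => (hXt j).trans hy_le
  -- The learned matrix becomes a parameter of the cube on which the event, fixed before the targets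
  -- and the coupling, is uniform.
  obtain ⟨θ, hθ, rfl⟩ := HypOT.exists_cubeMatrix_eq hr0
    (hL.abs_sub_le hs hω hxs hy0 hys hn (fun i => (hXS i).1) hXt' hMhat.1)
  have hdev := hdev θ hθ
  set L := HypOT.cubeMatrix K r θ
  have hLm : Measurable (HypOT.mobLayer s L) := HypOT.measurable_mobLayer s L
  have hLρ' : ∀ x, ‖x‖ ≤ Cx' → ‖HypOT.mobLayer s L x‖ ≤ ρ := fun x hx =>
    (HypOT.norm_mobLayer_le hs hxs (HypOT.frob_cubeMatrix_le hr0.le hθ) hx).trans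
      (le_max_right _ _)
  have hLρ : ∀ᵐ x ∂μs, ‖HypOT.mobLayer s L x‖ ≤ ρ := hμs'.mono hLρ'
  have hi1 := HypOT.integrable_pdist hs hρ0 hρs hLm hT.measurable hLρ hTρ
  have hi2 := HypOT.integrable_pdist hs hρ0 hρs hT.measurable hB hTρ hBρ
  have hi3 := HypOT.integrable_pdist hs hρ0 hρs hLm hB hLρ hBρ
  refine ⟨hi1, hi2, ?_⟩
  have hpop : ∫ x, HypOT.pdist s (HypOT.mobLayer s L x) (Tstar x) ∂μs ≤
      ∫ x, HypOT.pdist s (HypOT.mobLayer s L x) (HypOT.gyroBaryPop s M₀ x) ∂μs +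
        ∫ x, HypOT.pdist s (Tstar x) (HypOT.gyroBaryPop s M₀ x) ∂μs := by
    rw [← integral_add hi3 hi2]
    refine integral_mono_ae hi1 (hi3.add hi2) ?_
    filter_upwards [hLρ, hTρ, hBρ] with x hl ht hb
    rw [HypOT.pdist_comm hs (ht.trans_lt hρs) (hb.trans_lt hρs)]
    exact HypOT.pdist_triangle hs (hl.trans_lt hρs) (hb.trans_lt hρs) (ht.trans_lt hρs)
  have hemp : 1 / (n : ℝ) * ∑ i, HypOT.pdist s (HypOT.mobLayer s L (X i))
        (HypOT.gyroBaryPop s M₀ (X i)) ≤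
      1 / (n : ℝ) * ∑ i, HypOT.pdist s (HypOT.mobLayer s L (X i)) (HypOT.gyroBary s Mhat Xt i)
        + 1 / (n : ℝ) * ∑ i, HypOT.pdist s (HypOT.gyroBary s Mhat Xt i)
          (HypOT.gyroBaryPop s M₀ (X i)) := by
    rw [← mul_add, ← Finset.sum_add_distrib]
    refine mul_le_mul_of_nonneg_left (Finset.sum_le_sum fun i _ => ?_) (by positivity)
    exact HypOT.pdist_triangle hs ((hLρ' _ (hXS i).1).trans_lt hρs)
      (((HypOT.norm_gyroBary_le hs hy0 hys hMhat.1 hXt' i).trans hVρ).trans_lt hρs)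
      (((hXS i).2.trans hVρ).trans_lt hρs)
  have hconst : HypOT.qualityConst s ω Cx' Cy' K * (1 + √(Real.log (1 / δ))) / √(n : ℝ) ≤
      max (HypOT.qualityConst s ω Cx' Cy' K) 1 * (1 + √(Real.log (1 / δ))) / √(n : ℝ) := by
    gcongr
    exact le_max_left _ _
  have hdev' : _ ≤ HypOT.qualityConst s ω Cx' Cy' K * (1 + √(Real.log (1 / δ))) / √(n : ℝ) := hdev
  linarith
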